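/- Let a finite non-empty set of agents $k\in\{1,\dots,K\}$ and a finite set $\Theta$ of hypotheses with true hypothesis $\theta^\circ$ be given. At each time $i\ge 1$ agent $k$ observes a signal $\xi_{k,i}$; the vectors $\xi_i=(\xi_{1,i},\dots,\xi_{K,i})$ are i.i.d. over $i$ (not necessarily independent across agents), and $\xi_{k,i}$ has density $L_k(\cdot|\theta^\circ)$, where $L_k(\cdot|\theta)$, $\theta\in\Theta$, are probability densities with respect to a common $\sigma$-finite measure. Assume that $D(L_k(\cdot|\theta^\circ)\|L_k(\cdot|\theta))<\infty$ for all $k,\theta$, and that for every $\theta\ne\theta^\circ$ some agent $k$ has $D(L_k(\cdot|\theta^\circ)\|L_k(\cdot|\theta))>0$. Let $A=(a_{\ell k})$ be a primitive matrix with non-negative entries whose columns sum to one. Starting from probability vectors $\mu_{k,0}$ on $\Theta$ such that every hypothesis has positive initial belief for at least one agent, the beliefs under arithmetic-averaging (AA) diffusion are $$\psi_{k,i}(\theta)=\frac{L_k(\xi_{k,i}|\theta)\,\mu_{k,i-1}(\theta)}{\sum_{\theta'}L_k(\xi_{k,i}|\theta')\,\mu_{k,i-1}(\theta')},\qquad \mu_{k,i}(\theta)=\sum_{\ell}a_{\ell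 k}\,\psi_{\ell,i}(\theta).$$ Fix $\theta\neq\theta^\circ$, let $R_i$ be the diagonal matrix with entries $L_k(\xi_{k,i}|\theta)/L_k(\xi_{k,i}|\theta^\circ)$, and let $Y_i=(A^{T}R_1)(A^{T}R_2)\cdots(A^{T}R_i)$. Then there are a real number $\gamma$ such that for all $\ell,k$ $$\gamma=\lim_{i\to\infty}\tfrac1i\log[Y_i]_{\ell k}\ \text{ almost surely},\qquad \gamma=\lim_{i\to\infty}\tfrac1i\,\mathbb E\big[\log[Y_i]_{\ell k}\big],$$ and a real number $\rho^{\mathrm{AA}}=-\gamma$ such that for every agent $k$, almost surely, $\rho^{\mathrm{AA}}=-\lim_{i\to\infty}\frac1i\log\mu_{k,i}(\theta)$. Moreover, for all $i,j\ge1$, $$\tfrac1i\,\mathbb E\big[\log\|Y_i\|_-\big]\le\gamma\le\tfrac1j\,\mathbb E\big[\log\|Y_j\|_1\big],$$ where $\|X\|_-=\min_{k}\sum_{\ell}[X]_{\ell k}$ is the minimum and $\|X\|_1=\max_{k}\sum_{\ell}[X]_{\ell k}$ the maximum column sum of a matrix with non-negative entries, and both expectations are finite. As a consequence, for every agent $k$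 with $a_{kk}>0$, $$\rho^{\mathrm{AA}}\le-\log a_{kk}+D\big(L_k(\cdot|\theta^\circ)\,\|\,L_k(\cdot|\theta)\big);$$ in particular this holds for $k=1$ if $a_{11}>0$. -/

import Mathlib

open MeasureTheory ProbabilityTheory Filter Topology
open scoped Matrix

noncomputable section

namespace AADiffusion

variable {ι Θ Ω : Type*} [Fintype ι] [DecidableEq ι] [Nonempty ι] [Fintype Θ]
  {X : ι → Type*}

/-- The distribution with density `f` with respect to the reference measure `ν`. -/
def lawOf {S : Type*} [MeasurableSpace S] (ν : Measure S) (f : S → ℝ) : Measure S :=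
  ν.withDensity fun x => ENNReal.ofReal (f x)

/-- Likelihood ratio `L_k(x_k | θ) / L_k(x_k | θ₀)` of the observation of agent `k`. -/
def likelihoodRatio (L : ∀ k, Θ → X k → ℝ) (θ₀ θ : Θ) (x : ∀ k, X k) (k : ι) : ℝ :=
  L k θ (x k) / L k θ₀ (x k)

/-- The random matrix product `Y_i = (Aᵀ R_1) (Aᵀ R_2) ⋯ (Aᵀ R_i)`, where `R_j` is the diagonal
matrix of the likelihood ratios at time `j`. The vector of signals that the agents observe at
time `j + 1` is `ξ j`. -/
def prodY (A : Matrix ι ι ℝ) (L : ∀ k, Θ → X k → ℝ) (θ₀ θ : Θ) (ξ : ℕ → Ω → ∀ k, X k) :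
    ℕ → Ω → Matrix ι ι ℝ
  | 0, _ => 1
  | i + 1, ω => prodY A L θ₀ θ ξ i ω * (Aᵀ * Matrix.diagonal (likelihoodRatio L θ₀ θ (ξ i ω)))

/-- Minimum column sum of a matrix. -/
def colSumMin (M : Matrix ι ι ℝ) : ℝ :=
  Finset.univ.inf' Finset.univ_nonempty fun k => ∑ l, M l k

/-- Maximum column sum of a matrix (the `1`-norm of a matrix with non-negative entries). -/
def colSumMax (M : Matrix ι ι ℝ) : ℝ :=
  Finset.univ.sup' Finset.univ_nonempty fun k => ∑ l, M l k

/-- Local Bayesian update: the intermediate belief of agent `k` on `θ`. -/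
def bayes (L : ∀ k, Θ → X k → ℝ) (μ : ι → Θ → ℝ) (x : ∀ k, X k) (k : ι) (θ : Θ) : ℝ :=
  L k θ (x k) * μ k θ / ∑ θ', L k θ' (x k) * μ k θ'

/-- The beliefs `μ_{k,i}(θ)` under diffusion with arithmetic averaging, from the initial beliefs
`μ₀`: a local Bayesian update followed by the average `∑ ℓ, a_{ℓ k} ψ_{ℓ,i}(θ)`. -/
def belief (A : Matrix ι ι ℝ) (L : ∀ k, Θ → X k → ℝ) (μ₀ : ι → Θ → ℝ)
    (ξ : ℕ → Ω → ∀ k, X k) : ℕ → Ω → ι → Θ → ℝ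
  | 0, _ => μ₀
  | i + 1, ω => fun k θ => ∑ l, A l k * bayes L (belief A L μ₀ ξ i ω) (ξ i ω) l θ

variable [MeasurableSpace Ω]

/-- `γ` is the growth rate of the random matrices `Y i`: for every entry, `(1/i) log [Y_i]_{ℓ k}`
tends to `γ` almost surely and in expectation. (The entries are positive and their logarithms
integrable from some time on, so that neither `log` nor `∫` takes a default value.) -/
structure IsGrowthRate (P : Measure Ω) (Y : ℕ → Ω → Matrix ι ι ℝ) (γ : ℝ) : Prop where
  eventually_pos : ∀ᶠ i in atTop, ∀ᵐ ω ∂P, ∀ l k, 0 < Y i ω l k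
  eventually_integrable : ∀ᶠ i in atTop, ∀ l k, Integrable (fun ω => Real.log (Y i ω l k)) P
  tendsto_ae : ∀ l k, ∀ᵐ ω ∂P,
    Tendsto (fun i : ℕ => (1 / (i : ℝ)) * Real.log (Y i ω l k)) atTop (𝓝 γ)
  tendsto_integral : ∀ l k,
    Tendsto (fun i : ℕ => (1 / (i : ℝ)) * ∫ ω, Real.log (Y i ω l k) ∂P) atTop (𝓝 γ)

/-- `ρ` is the asymptotic decay rate of the beliefs `μ i ω k θ` on the hypothesis `θ`: for every
agent `k`, almost surely `-(1/i) log μ_{k,i}(θ)` tends to `ρ`. -/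
structure IsDecayRate (P : Measure Ω) (μ : ℕ → Ω → ι → Θ → ℝ) (θ : Θ) (ρ : ℝ) : Prop where
  eventually_pos : ∀ᶠ i in atTop, ∀ᵐ ω ∂P, ∀ k, 0 < μ i ω k θ
  tendsto_ae : ∀ k, ∀ᵐ ω ∂P,
    Tendsto (fun i : ℕ => -((1 / (i : ℝ)) * Real.log (μ i ω k θ))) atTop (𝓝 ρ)

end AADiffusion

end

open AADiffusion

/-! The maximum column sum is submultiplicative and the minimum column sum supermultiplicative, so
the means of their logarithms along `Y_n` are sub- and superadditive. Fekete's lemma gives both a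
rate, together with the bounds at each finite time. Every factor `Aᵀ R` lies entrywise between the
least and the greatest likelihood ratio times `Aᵀ`, and the logarithms of these scalars are
integrable because the divergences are finite. Since some power of `Aᵀ` is positive, the last few
factors make all column sums comparable, at a cost whose mean does not depend on `n`. Hence the two
rates agree; this is `γ` (`exists_rate`). Because they agree, one-sided almost sure bounds suffice,
and these come from the strong law applied to blocks (`eventually_le_of_subadditive`). Entries are
then squeezed between column sums (`exists_isGrowthRate`).

Without normalization, the belief on `θ` evolves linearly through the factors of `Y_i` multiplied in
reverse order. Transposition shows that the reversed products have a rate, and exchangeability of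
the i.i.d. signals identifies it with `γ` (`isGrowthRate_reverse`).

Normalization divides by each agent's predictive density `m_l` relative to the true density. It does
not change the rate once `log m_l → 0` almost surely (`ae_tendsto_log_predictive`), by Cesàro
averaging (`isDecayRate`). The convergence rests on a potential: with `π` the Perron vector of `A`,
the quantity `∑ π_k 𝔼 log μ_{k,i}(θ₀)` is at most `0`. By Jensen and `𝔼 m_l ≤ 1` it increases at
each step by at least the mean of `∑ π_l (m_l - 1 - log m_l) ≥ 0`, so these means are summable.

The final bound keeps only the path that stays at agent `k` in the diagonal entry of `Y_n`
(`log_diag_sub_le`). -/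

namespace AADiffusion

/-! ### Subadditive functions of segments of an i.i.d. sequence -/

section IID

variable {E Ω : Type*} [MeasurableSpace E] [MeasurableSpace Ω]

/-- A measurable sequence of independent identically distributed random variables. -/
structure IsIID (P : Measure Ω) (η : ℕ → Ω → E) : Prop where
  measurable : ∀ i, Measurable (η i)
  indep : iIndepFun η P
  ident : ∀ i, IdentDistrib (η i) (η 0) P P

/-- The observations at times `m, …, m + n - 1`. -/
def segment (η : ℕ → Ω → E) (m n : ℕ) (ω : Ω) : List E := List.ofFn fun i : Fin n => η (m + i) ω

omit [MeasurableSpace E] [MeasurableSpace Ω] in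
lemma segment_add (η : ℕ → Ω → E) (m a b : ℕ) (ω : Ω) :
    segment η m (a + b) ω = segment η m a ω ++ segment η (m + a) b ω := by
  simp only [segment, List.ofFn_add]
  congr 1
  simp [add_assoc]

omit [MeasurableSpace E] [MeasurableSpace Ω] in
@[simp] lemma segment_zero (η : ℕ → Ω → E) (m : ℕ) (ω : Ω) : segment η m 0 ω = [] := by
  simp [segment]

omit [MeasurableSpace E] [MeasurableSpace Ω] in
@[simp] lemma segment_one (η : ℕ → Ω → E) (m : ℕ) (ω : Ω) : segment η m 1 ω = [η m ω] := by
  simp [segment]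

variable {P : Measure Ω} [IsProbabilityMeasure P] {η : ℕ → Ω → E}

omit [IsProbabilityMeasure P] in
lemma IsIID.comp {F : Type*} [MeasurableSpace F] (h : IsIID P η) {f : E → F} (hf : Measurable f) :
    IsIID P (fun i ω => f (η i ω)) where
  measurable i := hf.comp (h.measurable i)
  indep := h.indep.comp (fun _ => f) (fun _ => hf)
  ident i := (h.ident i).comp hf

lemma IsIID.identDistrib_tuple (h : IsIID P η) {n : ℕ} {σ τ : Fin n → ℕ}
    (hσ : σ.Injective) (hτ : τ.Injective) :
    IdentDistrib (fun ω i => η (σ i) ω) (fun ω i => η (τ i) ω) P P := by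
  have key : ∀ σ : Fin n → ℕ, σ.Injective →
      P.map (fun ω i => η (σ i) ω) = Measure.pi fun _ => P.map (η 0) := by
    intro σ hσ
    rw [(iIndepFun_iff_map_fun_eq_pi_map fun i => (h.measurable (σ i)).aemeasurable).1
      (h.indep.precomp hσ)]
    congr 1
    funext i
    exact (h.ident (σ i)).map_eq
  refine ⟨?_, ?_, by rw [key σ hσ, key τ hτ]⟩
  · exact (measurable_pi_lambda _ fun i => h.measurable (σ i)).aemeasurable
  · exact (measurable_pi_lambda _ fun i => h.measurable (τ i)).aemeasurable

omit [IsProbabilityMeasure P] in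
lemma IsIID.indepFun_tuple (h : IsIID P η) {a b : ℕ} {σ : Fin a → ℕ} {τ : Fin b → ℕ}
    (hστ : ∀ i j, σ i ≠ τ j) :
    IndepFun (fun ω i => η (σ i) ω) (fun ω i => η (τ i) ω) P := by
  have hdisj : Disjoint (Finset.univ.image σ) (Finset.univ.image τ) := by
    rw [Finset.disjoint_left]
    intro x hx hx'
    simp only [Finset.mem_image, Finset.mem_univ, true_and] at hx hx'
    obtain ⟨i, rfl⟩ := hx
    obtain ⟨j, hj⟩ := hx'
    exact hστ i j hj.symm
  exact (h.indep.indepFun_finset _ _ hdisj h.measurable).comp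
    (φ := fun x (i : Fin a) => x ⟨σ i, Finset.mem_image_of_mem σ (Finset.mem_univ i)⟩)
    (ψ := fun x (i : Fin b) => x ⟨τ i, Finset.mem_image_of_mem τ (Finset.mem_univ i)⟩)
    (measurable_pi_lambda _ fun i => measurable_pi_apply _)
    (measurable_pi_lambda _ fun i => measurable_pi_apply _)

/-- Consecutive blocks of length `j` use disjoint sets of times. Pairwise independence is all that
the strong law needs. -/
lemma IsIID.blocks (h : IsIID P η) (m j : ℕ) :
    (∀ i, IdentDistrib (fun ω (l : Fin j) => η (m + i * j + l) ω) (fun ω l => η (0 + l) ω) P P) ∧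
    Pairwise fun i i' => IndepFun (fun ω (l : Fin j) => η (m + i * j + l) ω)
      (fun ω (l : Fin j) => η (m + i' * j + l) ω) P := by
  constructor
  · intro i
    refine h.identDistrib_tuple (fun a b hab => ?_) (fun a b hab => ?_)
    · exact Fin.ext (Nat.add_left_cancel hab)
    · exact Fin.ext (Nat.add_left_cancel hab)
  · intro i i' hii
    refine h.indepFun_tuple fun a b hab => hii ?_
    have hj : 0 < j := a.pos
    have h2 : i * j + a = i' * j + b := by omega
    -- The offsets are less than `j`, so Euclidean division by `j` recovers the block index.
    have h3 := congrArg (· / j) h2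
    simpa [Nat.mul_add_div hj, mul_comm _ j, Nat.div_eq_of_lt a.2, Nat.div_eq_of_lt b.2] using h3

/-- A subadditive function `g` of the segments of an i.i.d. sequence grows at most at the rate
`𝔼 g_j / j`, where `g_j` is the value of `g` at a segment of length `j`. -/
theorem IsIID.eventually_le_of_subadditive (h : IsIID P η) {g : List E → ℝ} (hg_nil : g [] ≤ 0)
    (hg_sub : ∀ a b, g (a ++ b) ≤ g a + g b)
    (hg_meas : ∀ n, Measurable fun x : Fin n → E => g (List.ofFn x))
    (hg_int : ∀ n, Integrable (fun ω => g (segment η 0 n ω)) P)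
    (m : ℕ) {j : ℕ} (hj : 0 < j) {c : ℝ} (hc : ∫ ω, g (segment η 0 j ω) ∂P < c * j) :
    ∀ᵐ ω ∂P, ∀ᶠ n : ℕ in atTop, g (segment η m n ω) ≤ c * n := by
  -- Used twice: for `g` itself on blocks of length `j`, and for `|g|` on single observations, which
  -- controls the incomplete last block.
  have law : ∀ k : ℕ, ∀ f : ℝ → ℝ, Measurable f →
      Integrable (fun ω => f (g (segment η 0 k ω))) P → ∀ᵐ ω ∂P,
      Tendsto (fun n : ℕ => (∑ i ∈ Finset.range n, f (g (segment η (m + i * k) k ω))) / n) atTop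
      (𝓝 (∫ ω, f (g (segment η 0 k ω)) ∂P)) := by
    intro k f hf hfi
    have hid := (h.blocks m k).1
    have hind := (h.blocks m k).2
    have hm := hf.comp (hg_meas k)
    have e : ∀ i, IdentDistrib (fun ω => f (g (segment η (m + i * k) k ω)))
        (fun ω => f (g (segment η 0 k ω))) P P := fun i => (hid i).comp hm
    have := strong_law_ae_real (μ := P) (fun i ω => f (g (segment η (m + i * k) k ω)))
      ((e 0).integrable_iff.2 hfi) (fun i i' hii => (hind hii).comp hm hm)
      (fun i => (e i).trans (e 0).symm)
    rwa [(e 0).integral_eq] at this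
  have law1 := law j id measurable_id (hg_int j)
  have law2 := law 1 (fun x => |x|) measurable_norm (hg_int 1).abs
  filter_upwards [law1, law2] with ω h1 h2
  simp only [segment_one, mul_one, id] at h1 h2
  set U : ℕ → ℝ := fun b => g (segment η (m + b * j) j ω)
  set V : ℕ → ℝ := fun i => |g [η (m + i) ω]|
  set v := ∫ ω, |g [η 0 ω]| ∂P
  set u := ∫ ω, g (segment η 0 j ω) ∂P
  have hblocks : ∀ q : ℕ, g (segment η m (q * j) ω) ≤ ∑ b ∈ Finset.range q, U b := by
    intro q
    induction q with
    | zero => simpa using hg_nil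
    | succ q ih =>
      rw [Nat.succ_mul, segment_add, Finset.sum_range_succ]
      exact (hg_sub _ _).trans (add_le_add ih le_rfl)
  -- The cost of the last `b` observations is written as a difference of two partial sums: after
  -- division by `n` both converge to `v`, so the incomplete block contributes `o(n)`.
  have hrest : ∀ a b : ℕ, g (segment η m (a + b) ω) ≤ g (segment η m a ω) +
      ((∑ i ∈ Finset.range (a + b), V i) - ∑ i ∈ Finset.range a, V i) := by
    intro a b
    induction b with
    | zero => simp
    | succ b ih =>
      rw [← add_assoc, segment_add _ _ (a + b) 1, Finset.sum_range_succ, segment_one]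
      have := hg_sub (segment η m (a + b) ω) [η (m + (a + b)) ω]
      have h3 : g [η (m + (a + b)) ω] ≤ V (a + b) := le_abs_self _
      linarith
  have hbound : ∀ n : ℕ, g (segment η m n ω) ≤ ∑ b ∈ Finset.range (n / j), U b +
      ((∑ i ∈ Finset.range n, V i) - ∑ i ∈ Finset.range (n / j * j), V i) := by
    intro n
    have h3 := hrest (n / j * j) (n % j)
    rw [Nat.div_add_mod'] at h3
    linarith [hblocks (n / j)]
  have hq : Tendsto (fun n : ℕ => n / j) atTop atTop := Nat.tendsto_div_const_atTop hj.ne'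
  have hqr : Tendsto (fun n : ℕ => ((n / j : ℕ) : ℝ) / n) atTop (𝓝 (1 / j)) := by
    have h3 := (tendsto_nat_floor_mul_div_atTop (R := ℝ) (a := 1 / (j : ℝ)) (by positivity)).comp
      tendsto_natCast_atTop_atTop
    refine h3.congr fun n => ?_
    simp only [Function.comp]
    rw [one_div_mul_eq_div, Nat.floor_div_natCast, Nat.floor_natCast]
  have hqj : Tendsto (fun n : ℕ => n / j * j) atTop atTop :=
    hq.atTop_mul_const' hj
  have hj' : (j : ℝ) ≠ 0 := by positivity
  have l1 : Tendsto (fun n : ℕ => (∑ b ∈ Finset.range (n / j), U b) / n) atTop (𝓝 (u * (1 / j))) := by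
    refine ((h1.comp hq).mul hqr).congr' ?_
    filter_upwards [hq.eventually_gt_atTop 0] with n hn
    have : ((n / j : ℕ) : ℝ) ≠ 0 := by positivity
    simp only [Function.comp]
    field_simp
  have l2 : Tendsto (fun n : ℕ => (∑ i ∈ Finset.range (n / j * j), V i) / n) atTop (𝓝 v) := by
    have := ((h2.comp hqj).mul (hqr.mul_const (j : ℝ)))
    rw [one_div, inv_mul_cancel₀ hj', mul_one] at this
    refine this.congr' ?_
    filter_upwards [hq.eventually_gt_atTop 0] with n hn
    have : ((n / j : ℕ) : ℝ) ≠ 0 := by positivity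
    simp only [Function.comp]
    push_cast
    field_simp
  have l3 := l1.add (h2.sub l2)
  rw [sub_self, add_zero] at l3
  have hlt : u * (1 / j) < c := by
    rw [mul_one_div, div_lt_iff₀ (by positivity)]; exact hc
  filter_upwards [l3.eventually_lt_const hlt, eventually_gt_atTop 0] with n hn hn0
  refine (hbound n).trans ?_
  have hn' : (0 : ℝ) < n := by exact_mod_cast hn0
  rw [← sub_div, ← add_div, div_lt_iff₀ hn'] at hn
  exact hn.le

end IID

/-! ### Column sums and powers of primitive matrices -/

section ColumnSums

variable {ι : Type*} [Fintype ι] [Nonempty ι]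

lemma colSumMin_le (X : Matrix ι ι ℝ) (k : ι) : colSumMin X ≤ ∑ l, X l k :=
  Finset.inf'_le _ (Finset.mem_univ k)

lemma le_colSumMax (X : Matrix ι ι ℝ) (k : ι) : ∑ l, X l k ≤ colSumMax X :=
  Finset.le_sup' (fun k => ∑ l, X l k) (Finset.mem_univ k)

lemma le_colSumMin {X : Matrix ι ι ℝ} {c : ℝ} (h : ∀ k, c ≤ ∑ l, X l k) : c ≤ colSumMin X :=
  Finset.le_inf' _ _ fun k _ => h k

lemma colSumMax_le {X : Matrix ι ι ℝ} {c : ℝ} (h : ∀ k, ∑ l, X l k ≤ c) : colSumMax X ≤ c :=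
  Finset.sup'_le _ _ fun k _ => h k

lemma lt_colSumMin {X : Matrix ι ι ℝ} {c : ℝ} (h : ∀ k, c < ∑ l, X l k) : c < colSumMin X :=
  (Finset.lt_inf'_iff _).2 fun k _ => h k

lemma colSumMin_le_colSumMax (X : Matrix ι ι ℝ) : colSumMin X ≤ colSumMax X :=
  (colSumMin_le X (Classical.arbitrary ι)).trans (le_colSumMax X _)

lemma entry_le_colSumMax {X : Matrix ι ι ℝ} (hX : ∀ l k, 0 ≤ X l k) (l k : ι) :
    X l k ≤ colSumMax X :=
  (Finset.single_le_sum (fun l _ => hX l k) (Finset.mem_univ l)).trans (le_colSumMax X k)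

omit [Nonempty ι] in
lemma colSum_mul (X Y : Matrix ι ι ℝ) (k : ι) :
    ∑ l, (X * Y) l k = ∑ m, (∑ l, X l m) * Y m k := by
  simp only [Matrix.mul_apply, Finset.sum_mul]
  exact Finset.sum_comm

lemma colSumMin_nonneg {X : Matrix ι ι ℝ} (hX : ∀ l k, 0 ≤ X l k) : 0 ≤ colSumMin X :=
  le_colSumMin fun k => Finset.sum_nonneg fun l _ => hX l k

lemma colSumMax_nonneg {X : Matrix ι ι ℝ} (hX : ∀ l k, 0 ≤ X l k) : 0 ≤ colSumMax X :=
  (colSumMin_nonneg hX).trans (colSumMin_le_colSumMax X)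

lemma colSumMin_mul_le {X Y : Matrix ι ι ℝ} (hX : ∀ l k, 0 ≤ X l k) (hY : ∀ l k, 0 ≤ Y l k) :
    colSumMin X * colSumMin Y ≤ colSumMin (X * Y) := by
  refine le_colSumMin fun k => ?_
  rw [colSum_mul]
  calc colSumMin X * colSumMin Y ≤ colSumMin X * ∑ m, Y m k :=
        mul_le_mul_of_nonneg_left (colSumMin_le Y k) (colSumMin_nonneg hX)
    _ = ∑ m, colSumMin X * Y m k := Finset.mul_sum _ _ _
    _ ≤ _ := Finset.sum_le_sum fun m _ => mul_le_mul_of_nonneg_right (colSumMin_le X m) (hY m k)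

lemma colSumMax_mul_le {X Y : Matrix ι ι ℝ} (hX : ∀ l k, 0 ≤ X l k) (hY : ∀ l k, 0 ≤ Y l k) :
    colSumMax (X * Y) ≤ colSumMax X * colSumMax Y := by
  refine colSumMax_le fun k => ?_
  rw [colSum_mul]
  calc ∑ m, (∑ l, X l m) * Y m k ≤ ∑ m, colSumMax X * Y m k :=
        Finset.sum_le_sum fun m _ => mul_le_mul_of_nonneg_right (le_colSumMax X m) (hY m k)
    _ = colSumMax X * ∑ m, Y m k := (Finset.mul_sum _ _ _).symm
    _ ≤ _ := mul_le_mul_of_nonneg_left (le_colSumMax Y k) (colSumMax_nonneg hX)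

variable [DecidableEq ι]

lemma colSumMin_one : colSumMin (1 : Matrix ι ι ℝ) = 1 := by
  simp [colSumMin, Matrix.one_apply]

lemma colSumMax_one : colSumMax (1 : Matrix ι ι ℝ) = 1 := by
  simp [colSumMax, Matrix.one_apply]

/-- A zero column of `B` would remain a zero column in every positive power of `B`. -/
lemma colSumMin_pos_of_isPrimitive {B : Matrix ι ι ℝ} (hB : B.IsPrimitive) : 0 < colSumMin B := by
  refine lt_colSumMin fun k => ?_
  obtain ⟨p, hp, hpos⟩ := hB.exists_pos_pow
  obtain ⟨q, rfl⟩ : ∃ q, p = q + 1 := ⟨p - 1, by omega⟩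
  refine (Finset.sum_nonneg fun l _ => hB.nonneg l k).lt_of_ne' fun h0 => ?_
  have h1 := (Finset.sum_eq_zero_iff_of_nonneg fun l _ => hB.nonneg l k).1 h0
  have h2 := hpos k k
  rw [pow_succ, Matrix.mul_apply, Finset.sum_eq_zero] at h2
  · exact lt_irrefl _ h2
  · intro m _
    rw [h1 m (Finset.mem_univ m), mul_zero]

omit [Nonempty ι] in
lemma pow_entry_nonneg {B : Matrix ι ι ℝ} (hB : ∀ l k, 0 ≤ B l k) (n : ℕ) (l k : ι) :
    0 ≤ (B ^ n) l k := by
  induction n generalizing l k with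
  | zero => rw [pow_zero, Matrix.one_apply]; split_ifs <;> norm_num
  | succ n ih =>
    rw [pow_succ, Matrix.mul_apply]
    exact Finset.sum_nonneg fun m _ => mul_nonneg (ih l m) (hB m k)

/-- Positivity persists after the first positive power, because each column of `B` has a positive
entry. -/
lemma exists_forall_pow_pos {B : Matrix ι ι ℝ} (hB : B.IsPrimitive) :
    ∃ p, 0 < p ∧ ∀ n, p ≤ n → ∀ l k, 0 < (B ^ n) l k := by
  obtain ⟨p, hp, hpos⟩ := hB.exists_pos_pow
  refine ⟨p, hp, fun n hn => ?_⟩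
  induction n, hn using Nat.le_induction with
  | base => exact hpos
  | succ n hn ih =>
    intro l k
    rw [pow_succ, Matrix.mul_apply]
    have h0 := (colSumMin_pos_of_isPrimitive hB).trans_le (colSumMin_le B k)
    obtain ⟨m, -, hm⟩ := Finset.exists_lt_of_sum_lt (s := Finset.univ) (f := fun _ : ι => (0 : ℝ))
      (g := fun m => B m k) (by simpa using h0)
    exact Finset.sum_pos' (fun m _ => mul_nonneg (ih l m).le (hB.nonneg m k))
      ⟨m, Finset.mem_univ m, mul_pos (ih l m) hm⟩

omit [Fintype ι] [DecidableEq ι] [Nonempty ι] in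
lemma isPrimitive_transpose [Fintype ι] [DecidableEq ι] {B : Matrix ι ι ℝ} (hB : B.IsPrimitive) :
    Bᵀ.IsPrimitive where
  nonneg i j := hB.nonneg j i
  exists_pos_pow := by
    obtain ⟨p, hp, hpos⟩ := hB.exists_pos_pow
    exact ⟨p, hp, fun i j => by rw [← Matrix.transpose_pow]; exact hpos j i⟩

end ColumnSums

/-! ### Products of matrices comparable to a primitive matrix -/

section Products

variable {ι E : Type*} [Fintype ι] [DecidableEq ι] [Nonempty ι]

/-- The product of the matrices attached to a list of observations. -/
def listProd (M : E → Matrix ι ι ℝ) (l : List E) : Matrix ι ι ℝ := (l.map M).prod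

omit [Nonempty ι] in
@[simp] lemma listProd_nil (M : E → Matrix ι ι ℝ) : listProd M [] = 1 := rfl

omit [Nonempty ι] in
lemma listProd_cons (M : E → Matrix ι ι ℝ) (x : E) (l : List E) :
    listProd M (x :: l) = M x * listProd M l := by simp [listProd]

omit [Nonempty ι] in
lemma listProd_append (M : E → Matrix ι ι ℝ) (a b : List E) :
    listProd M (a ++ b) = listProd M a * listProd M b := by simp [listProd]

/-- Up to the scalar factors `c x` and `C x`, each matrix `M x` is the primitive matrix `B`. -/
structure IsComparable (B : Matrix ι ι ℝ) (M : E → Matrix ι ι ℝ) (c C : E → ℝ) : Prop where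
  prim : B.IsPrimitive
  c_pos : ∀ x, 0 < c x
  C_pos : ∀ x, 0 < C x
  lower : ∀ x l k, c x * B l k ≤ M x l k
  upper : ∀ x l k, M x l k ≤ C x * B l k

namespace IsComparable

variable {B : Matrix ι ι ℝ} {M : E → Matrix ι ι ℝ} {c C : E → ℝ}

omit [Nonempty ι] in
lemma nonneg (h : IsComparable B M c C) (x : E) (l k : ι) : 0 ≤ M x l k :=
  (mul_nonneg (h.c_pos x).le (h.prim.nonneg l k)).trans (h.lower x l k)

omit [Nonempty ι] in
lemma listProd_nonneg (h : IsComparable B M c C) (s : List E) (l k : ι) :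
    0 ≤ listProd M s l k := by
  induction s generalizing l k with
  | nil => rw [listProd_nil, Matrix.one_apply]; split_ifs <;> norm_num
  | cons x s ih =>
    rw [listProd_cons, Matrix.mul_apply]
    exact Finset.sum_nonneg fun m _ => mul_nonneg (h.nonneg x l m) (ih m k)

omit [Nonempty ι] in
-- The scalar bounds multiply along the list. Their product is written as the exponential of a sum
-- of logarithms because expectations of such sums are additive in the length.
lemma listProd_lower (h : IsComparable B M c C) (s : List E) (l k : ι) :
    Real.exp (s.map fun x => Real.log (c x)).sum * (B ^ s.length) l k ≤ listProd M s l k := by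
  induction s generalizing l k with
  | nil => simp
  | cons x s ih =>
    rw [listProd_cons, Matrix.mul_apply, List.length_cons, pow_succ', Matrix.mul_apply,
      List.map_cons, List.sum_cons, Real.exp_add, Real.exp_log (h.c_pos x), Finset.mul_sum]
    refine Finset.sum_le_sum fun m _ => ?_
    calc c x * Real.exp (s.map fun x => Real.log (c x)).sum * (B l m * (B ^ s.length) m k)
        = (c x * B l m) * (Real.exp (s.map fun x => Real.log (c x)).sum * (B ^ s.length) m k) := by
          ring
      _ ≤ _ := mul_le_mul (h.lower x l m) (ih m k)
        (mul_nonneg (Real.exp_pos _).le (pow_entry_nonneg h.prim.nonneg _ _ _)) (h.nonneg x l m)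

omit [Nonempty ι] in
lemma listProd_upper (h : IsComparable B M c C) (s : List E) (l k : ι) :
    listProd M s l k ≤ Real.exp (s.map fun x => Real.log (C x)).sum * (B ^ s.length) l k := by
  induction s generalizing l k with
  | nil => simp
  | cons x s ih =>
    rw [listProd_cons, Matrix.mul_apply, List.length_cons, pow_succ', Matrix.mul_apply,
      List.map_cons, List.sum_cons, Real.exp_add, Real.exp_log (h.C_pos x), Finset.mul_sum]
    refine Finset.sum_le_sum fun m _ => ?_
    calc M x l m * listProd M s m k
        ≤ (C x * B l m) * (Real.exp (s.map fun x => Real.log (C x)).sum * (B ^ s.length) m k) :=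
          mul_le_mul (h.upper x l m) (ih m k) (h.listProd_nonneg s m k)
            (mul_nonneg (h.C_pos x).le (h.prim.nonneg l m))
      _ = _ := by ring

lemma colSumMin_listProd_pos (h : IsComparable B M c C) (s : List E) :
    0 < colSumMin (listProd M s) := by
  induction s with
  | nil => rw [listProd_nil, colSumMin_one]; exact one_pos
  | cons x s ih =>
    rw [listProd_cons]
    refine (mul_pos ?_ ih).trans_le (colSumMin_mul_le (h.nonneg x) (h.listProd_nonneg s))
    refine lt_colSumMin fun k => ?_
    calc 0 < c x * ∑ l, B l k := mul_pos (h.c_pos x)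
          ((colSumMin_pos_of_isPrimitive h.prim).trans_le (colSumMin_le B k))
      _ = ∑ l, c x * B l k := Finset.mul_sum _ _ _
      _ ≤ ∑ l, M x l k := Finset.sum_le_sum fun l _ => h.lower x l k

lemma colSumMax_listProd_pos (h : IsComparable B M c C) (s : List E) :
    0 < colSumMax (listProd M s) :=
  (h.colSumMin_listProd_pos s).trans_le (colSumMin_le_colSumMax _)

lemma log_colSumMax_append_le (h : IsComparable B M c C) (a b : List E) :
    Real.log (colSumMax (listProd M (a ++ b))) ≤
      Real.log (colSumMax (listProd M a)) + Real.log (colSumMax (listProd M b)) := by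
  rw [← Real.log_mul (h.colSumMax_listProd_pos a).ne' (h.colSumMax_listProd_pos b).ne',
    listProd_append]
  refine Real.log_le_log ?_ (colSumMax_mul_le (h.listProd_nonneg a) (h.listProd_nonneg b))
  rw [← listProd_append]; exact h.colSumMax_listProd_pos _

lemma le_log_colSumMin_append (h : IsComparable B M c C) (a b : List E) :
    Real.log (colSumMin (listProd M a)) + Real.log (colSumMin (listProd M b)) ≤
      Real.log (colSumMin (listProd M (a ++ b))) := by
  rw [← Real.log_mul (h.colSumMin_listProd_pos a).ne' (h.colSumMin_listProd_pos b).ne',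
    listProd_append]
  exact Real.log_le_log (mul_pos (h.colSumMin_listProd_pos a) (h.colSumMin_listProd_pos b))
    (colSumMin_mul_le (h.listProd_nonneg a) (h.listProd_nonneg b))

/-- The column sums are controlled by the scalar bounds. -/
lemma exists_log_colSum_bounds (h : IsComparable B M c C) (n : ℕ) :
    ∃ D D' : ℝ, ∀ s : List E, s.length = n →
      D + (s.map fun x => Real.log (c x)).sum ≤ Real.log (colSumMin (listProd M s)) ∧
      Real.log (colSumMax (listProd M s)) ≤ D' + (s.map fun x => Real.log (C x)).sum := by
  have hpos : 0 < colSumMin (B ^ n) := by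
    induction n with
    | zero => rw [pow_zero, colSumMin_one]; exact one_pos
    | succ n ih =>
      rw [pow_succ]
      exact (mul_pos ih (colSumMin_pos_of_isPrimitive h.prim)).trans_le
        (colSumMin_mul_le (pow_entry_nonneg h.prim.nonneg n) h.prim.nonneg)
  have hpos' : 0 < colSumMax (B ^ n) := hpos.trans_le (colSumMin_le_colSumMax _)
  refine ⟨Real.log (colSumMin (B ^ n)), Real.log (colSumMax (B ^ n)), fun s hs => ⟨?_, ?_⟩⟩
  · rw [Real.le_log_iff_exp_le (h.colSumMin_listProd_pos s), Real.exp_add, Real.exp_log hpos]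
    refine le_colSumMin fun k => ?_
    calc colSumMin (B ^ n) * Real.exp (s.map fun x => Real.log (c x)).sum
        ≤ (∑ l, (B ^ n) l k) * Real.exp (s.map fun x => Real.log (c x)).sum :=
          mul_le_mul_of_nonneg_right (colSumMin_le _ k) (Real.exp_pos _).le
      _ = ∑ l, Real.exp (s.map fun x => Real.log (c x)).sum * (B ^ n) l k := by
          rw [Finset.sum_mul]; exact Finset.sum_congr rfl fun l _ => mul_comm _ _
      _ ≤ _ := Finset.sum_le_sum fun l _ => hs ▸ h.listProd_lower s l k
  · rw [Real.log_le_iff_le_exp (h.colSumMax_listProd_pos s), Real.exp_add, Real.exp_log hpos']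
    refine colSumMax_le fun k => ?_
    calc ∑ l, listProd M s l k
        ≤ ∑ l, Real.exp (s.map fun x => Real.log (C x)).sum * (B ^ n) l k :=
          Finset.sum_le_sum fun l _ => hs ▸ h.listProd_upper s l k
      _ = (∑ l, (B ^ n) l k) * Real.exp (s.map fun x => Real.log (C x)).sum := by
          rw [Finset.sum_mul]; exact Finset.sum_congr rfl fun l _ => mul_comm _ _
      _ ≤ _ := mul_le_mul_of_nonneg_right (le_colSumMax _ k) (Real.exp_pos _).le

omit [Nonempty ι] in
lemma listProd_pos (h : IsComparable B M c C) {s : List E} (hs : ∀ l k, 0 < (B ^ s.length) l k)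
    (l k : ι) : 0 < listProd M s l k :=
  (mul_pos (Real.exp_pos _) (hs l k)).trans_le (h.listProd_lower s l k)

/-- If the last factors form a positive matrix, then the column sums are comparable. -/
lemma exists_log_colSumMax_append_le (h : IsComparable B M c C) {p : ℕ}
    (hp : ∀ l k, 0 < (B ^ p) l k) :
    ∃ D : ℝ, ∀ a b : List E, b.length = p →
      Real.log (colSumMax (listProd M (a ++ b))) ≤ Real.log (colSumMin (listProd M (a ++ b))) +
        ((b.map fun x => Real.log (C x)).sum - (b.map fun x => Real.log (c x)).sum + D) := by
  obtain ⟨⟨l₁, k₁⟩, h₁⟩ := Finite.exists_min fun q : ι × ι => (B ^ p) q.1 q.2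
  obtain ⟨⟨l₂, k₂⟩, h₂⟩ := Finite.exists_max fun q : ι × ι => (B ^ p) q.1 q.2
  refine ⟨Real.log ((B ^ p) l₂ k₂) - Real.log ((B ^ p) l₁ k₁), fun a b hb => ?_⟩
  -- Each column sum of the product is a combination of the column sums of the prefix, weighted by
  -- entries of the suffix. The suffix entries lie between scalar multiples of the least and the
  -- greatest entry of `B ^ p`, so every column sum is comparable to `S`, and `S` cancels.
  set S := ∑ m, ∑ l, listProd M a l m
  have hcol : ∀ m, 0 < ∑ l, listProd M a l m := fun m =>
    (h.colSumMin_listProd_pos a).trans_le (colSumMin_le _ m)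
  have hS : 0 < S := Finset.sum_pos (fun m _ => hcol m) Finset.univ_nonempty
  have hlo : S * (Real.exp (b.map fun x => Real.log (c x)).sum * (B ^ p) l₁ k₁) ≤
      colSumMin (listProd M (a ++ b)) := by
    refine le_colSumMin fun k => ?_
    rw [listProd_append, colSum_mul, Finset.sum_mul]
    refine Finset.sum_le_sum fun m _ => mul_le_mul_of_nonneg_left ?_ (hcol m).le
    exact (mul_le_mul_of_nonneg_left (h₁ (m, k)) (Real.exp_pos _).le).trans
      (hb ▸ h.listProd_lower b m k)
  have hup : colSumMax (listProd M (a ++ b)) ≤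
      S * (Real.exp (b.map fun x => Real.log (C x)).sum * (B ^ p) l₂ k₂) := by
    refine colSumMax_le fun k => ?_
    rw [listProd_append, colSum_mul, Finset.sum_mul]
    refine Finset.sum_le_sum fun m _ => mul_le_mul_of_nonneg_left ?_ (hcol m).le
    exact (hb ▸ h.listProd_upper b m k).trans
      (mul_le_mul_of_nonneg_left (h₂ (m, k)) (Real.exp_pos _).le)
  have hlo' := Real.log_le_log (mul_pos hS (mul_pos (Real.exp_pos _) (hp l₁ k₁))) hlo
  have hup' := Real.log_le_log (h.colSumMax_listProd_pos _) hup
  rw [Real.log_mul hS.ne' (mul_pos (Real.exp_pos _) (hp _ _)).ne',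
    Real.log_mul (Real.exp_pos _).ne' (hp _ _).ne', Real.log_exp] at hlo' hup'
  linarith

/-- If the first factors form a positive matrix, then the entries of the product are bounded below
by the column sums of the other factors. -/
lemma exists_le_log_entry_append (h : IsComparable B M c C) {p : ℕ}
    (hp : ∀ l k, 0 < (B ^ p) l k) :
    ∃ D : ℝ, ∀ (a b : List E) (l k : ι), a.length = p →
      D + (a.map fun x => Real.log (c x)).sum + Real.log (colSumMin (listProd M b)) ≤
        Real.log (listProd M (a ++ b) l k) := by
  obtain ⟨⟨l₁, k₁⟩, h₁⟩ := Finite.exists_min fun q : ι × ι => (B ^ p) q.1 q.2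
  refine ⟨Real.log ((B ^ p) l₁ k₁), fun a b l k ha => ?_⟩
  have hb := h.colSumMin_listProd_pos b
  -- In `∑ m, a_{lm} b_{mk}` the entries of the prefix are bounded below uniformly, which leaves a
  -- column sum of the suffix.
  have hlo : (Real.exp (a.map fun x => Real.log (c x)).sum * (B ^ p) l₁ k₁) *
      colSumMin (listProd M b) ≤ listProd M (a ++ b) l k := by
    refine (mul_le_mul_of_nonneg_left (colSumMin_le _ k)
      (mul_pos (Real.exp_pos _) (hp _ _)).le).trans ?_
    rw [listProd_append, Matrix.mul_apply, Finset.mul_sum]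
    refine Finset.sum_le_sum fun m _ => mul_le_mul_of_nonneg_right ?_ (h.listProd_nonneg b m k)
    exact (mul_le_mul_of_nonneg_left (h₁ (l, m)) (Real.exp_pos _).le).trans
      (ha ▸ h.listProd_lower a l m)
  have := Real.log_le_log (mul_pos (mul_pos (Real.exp_pos _) (hp _ _)) hb) hlo
  rw [Real.log_mul (mul_pos (Real.exp_pos _) (hp _ _)).ne' hb.ne',
    Real.log_mul (Real.exp_pos _).ne' (hp _ _).ne', Real.log_exp] at this
  linarith

end IsComparable

section Measurability

variable [MeasurableSpace E]

omit [Nonempty ι] in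
lemma measurable_listProd_ofFn {M : E → Matrix ι ι ℝ} (hM : ∀ l k, Measurable fun x => M x l k)
    (n : ℕ) (l k : ι) : Measurable fun x : Fin n → E => listProd M (List.ofFn x) l k := by
  induction n generalizing l k with
  | zero => simp
  | succ n ih =>
    simp only [List.ofFn_succ, listProd_cons, Matrix.mul_apply]
    refine Finset.measurable_sum _ fun m _ => ((hM l m).comp (measurable_pi_apply 0)).mul ?_
    exact (ih m k).comp (measurable_pi_lambda _ fun i => measurable_pi_apply i.succ)

omit [DecidableEq ι] in
lemma measurable_colSumMin {α : Type*} [MeasurableSpace α] {X : α → Matrix ι ι ℝ}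
    (hX : ∀ l k, Measurable fun x => X x l k) : Measurable fun x => colSumMin (X x) := by
  have := Finset.inf'_induction (Finset.univ_nonempty (α := ι)) (fun k x => ∑ l, X x l k)
    (p := Measurable) (fun _ h₁ _ h₂ => h₁.inf h₂)
    fun k _ => Finset.measurable_sum _ fun l _ => hX l k
  convert this using 1
  ext x
  simp [colSumMin, Finset.inf'_apply]

omit [DecidableEq ι] in
lemma measurable_colSumMax {α : Type*} [MeasurableSpace α] {X : α → Matrix ι ι ℝ}
    (hX : ∀ l k, Measurable fun x => X x l k) : Measurable fun x => colSumMax (X x) := by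
  have := Finset.measurable_sup' (Finset.univ_nonempty (α := ι)) (f := fun k x => ∑ l, X x l k)
    fun k _ => Finset.measurable_sum _ fun l _ => hX l k
  convert this using 1
  ext x
  simp [colSumMax, Finset.sup'_apply]

end Measurability

end Products

/-! ### Laws and expectations of functions of segments -/

section SegmentIntegrals

variable {E Ω : Type*} [MeasurableSpace E] [MeasurableSpace Ω] {P : Measure Ω}
  [IsProbabilityMeasure P] {η : ℕ → Ω → E}

lemma IsIID.identDistrib_segment (h : IsIID P η) {g : List E → ℝ} {n : ℕ}
    (hg : Measurable fun x : Fin n → E => g (List.ofFn x)) (m : ℕ) :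
    IdentDistrib (fun ω => g (segment η m n ω)) (fun ω => g (segment η 0 n ω)) P P := by
  refine IdentDistrib.comp (u := fun x : Fin n → E => g (List.ofFn x))
    (h.identDistrib_tuple (σ := fun i : Fin n => m + i) (τ := fun i : Fin n => 0 + i)
      (fun a b hab => ?_) (fun a b hab => ?_)) hg
  · exact Fin.ext (Nat.add_left_cancel hab)
  · exact Fin.ext (Nat.add_left_cancel hab)

omit [IsProbabilityMeasure P] in
lemma IsIID.measurable_segment (h : IsIID P η) {g : List E → ℝ} {n : ℕ}
    (hg : Measurable fun x : Fin n → E => g (List.ofFn x)) (m : ℕ) :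
    Measurable fun ω => g (segment η m n ω) :=
  hg.comp (measurable_pi_lambda (fun ω (i : Fin n) => η (m + i) ω) fun _ => h.measurable _)

omit [IsProbabilityMeasure P] in
lemma IsIID.integrable_apply (h : IsIID P η) {f : E → ℝ} (hf : Measurable f)
    (hint : Integrable (fun ω => f (η 0 ω)) P) (i : ℕ) : Integrable (fun ω => f (η i ω)) P :=
  ((h.ident i).comp hf).integrable_iff.2 hint

omit [IsProbabilityMeasure P] in
lemma IsIID.integrable_sum_segment (h : IsIID P η) {f : E → ℝ} (hf : Measurable f)
    (hint : Integrable (fun ω => f (η 0 ω)) P) (m n : ℕ) :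
    Integrable (fun ω => ((segment η m n ω).map f).sum) P := by
  simp only [segment, List.map_ofFn, List.sum_ofFn, Function.comp]
  exact integrable_finsetSum _ fun i _ => h.integrable_apply hf hint _

omit [IsProbabilityMeasure P] in
lemma IsIID.integral_sum_segment (h : IsIID P η) {f : E → ℝ} (hf : Measurable f)
    (hint : Integrable (fun ω => f (η 0 ω)) P) (m n : ℕ) :
    ∫ ω, ((segment η m n ω).map f).sum ∂P = n * ∫ ω, f (η 0 ω) ∂P := by
  simp only [segment, List.map_ofFn, List.sum_ofFn, Function.comp]
  rw [integral_finsetSum _ fun i _ => h.integrable_apply hf hint _]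
  have : ∀ i, ∫ ω, f (η i ω) ∂P = ∫ ω, f (η 0 ω) ∂P := fun i =>
    ((h.ident i).comp hf).integral_eq
  simp [this]

omit [MeasurableSpace E] [MeasurableSpace Ω] in
@[simp] lemma length_segment (η : ℕ → Ω → E) (m n : ℕ) (ω : Ω) :
    (segment η m n ω).length = n := by simp [segment]

end SegmentIntegrals

lemma tendsto_one_div_mul_of_eventually {u : ℕ → ℝ} {γ : ℝ}
    (hlo : ∀ ε : ℝ, 0 < ε → ∀ᶠ n : ℕ in atTop, (γ - ε) * n ≤ u n)
    (hup : ∀ ε : ℝ, 0 < ε → ∀ᶠ n : ℕ in atTop, u n ≤ (γ + ε) * n) :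
    Tendsto (fun n : ℕ => (1 / (n : ℝ)) * u n) atTop (𝓝 γ) := by
  rw [Metric.tendsto_atTop']
  intro ε hε
  have := ((hlo (ε / 2) (by positivity)).and (hup (ε / 2) (by positivity))).and
    (eventually_gt_atTop 0)
  obtain ⟨N, hN⟩ := eventually_atTop.1 this
  refine ⟨N, fun n hn => ?_⟩
  obtain ⟨⟨h1, h2⟩, h0⟩ := hN n hn.le
  have h0' : (0 : ℝ) < n := by exact_mod_cast h0
  rw [Real.dist_eq, one_div_mul_eq_div, abs_lt]
  constructor
  · have := (le_div_iff₀ h0').2 h1; linarith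
  · have := (div_le_iff₀ h0').2 h2; linarith

/-! ### The growth rate of the random products -/

section GrowthRate

variable {ι E Ω : Type*} [Fintype ι] [DecidableEq ι] [Nonempty ι] [MeasurableSpace E]
  [MeasurableSpace Ω]

/-- Independent identically distributed random matrices that are comparable to a primitive matrix,
with log-integrable scalar bounds. -/
structure IsRandomProduct (P : Measure Ω) (η : ℕ → Ω → E) (B : Matrix ι ι ℝ)
    (M : E → Matrix ι ι ℝ) (c C : E → ℝ) : Prop where
  iid : IsIID P η
  comparable : IsComparable B M c C
  measurable : ∀ l k, Measurable fun x => M x l k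
  measurable_c : Measurable c
  measurable_C : Measurable C
  integrable_c : Integrable (fun ω => Real.log (c (η 0 ω))) P
  integrable_C : Integrable (fun ω => Real.log (C (η 0 ω))) P

namespace IsRandomProduct

variable {P : Measure Ω} [IsProbabilityMeasure P] {η : ℕ → Ω → E} {B : Matrix ι ι ℝ}
  {M : E → Matrix ι ι ℝ} {c C : E → ℝ}

omit [IsProbabilityMeasure P] [Nonempty ι] in
lemma integrable_sum_c (h : IsRandomProduct P η B M c C) (m n : ℕ) :
    Integrable (fun ω => ((segment η m n ω).map fun x => Real.log (c x)).sum) P :=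
  h.iid.integrable_sum_segment h.measurable_c.log h.integrable_c m n

omit [IsProbabilityMeasure P] [Nonempty ι] in
lemma integrable_sum_C (h : IsRandomProduct P η B M c C) (m n : ℕ) :
    Integrable (fun ω => ((segment η m n ω).map fun x => Real.log (C x)).sum) P :=
  h.iid.integrable_sum_segment h.measurable_C.log h.integrable_C m n

omit [IsProbabilityMeasure P] in
lemma measurable_logMin (h : IsRandomProduct P η B M c C) (n : ℕ) :
    Measurable fun x : Fin n → E => Real.log (colSumMin (listProd M (List.ofFn x))) :=
  (measurable_colSumMin (measurable_listProd_ofFn h.measurable n)).log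

omit [IsProbabilityMeasure P] in
lemma measurable_logMax (h : IsRandomProduct P η B M c C) (n : ℕ) :
    Measurable fun x : Fin n → E => Real.log (colSumMax (listProd M (List.ofFn x))) :=
  (measurable_colSumMax (measurable_listProd_ofFn h.measurable n)).log

lemma integrable_logMin (h : IsRandomProduct P η B M c C) (m n : ℕ) :
    Integrable (fun ω => Real.log (colSumMin (listProd M (segment η m n ω)))) P := by
  obtain ⟨D, D', hD⟩ := h.comparable.exists_log_colSum_bounds n
  refine integrable_of_le_of_le
    (h.iid.measurable_segment (g := fun s => Real.log (colSumMin (listProd M s)))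
      (h.measurable_logMin n) m).aestronglyMeasurable
    (ae_of_all _ fun ω => (hD _ (length_segment η m n ω)).1)
    (ae_of_all _ fun ω => (Real.log_le_log (h.comparable.colSumMin_listProd_pos _)
      (colSumMin_le_colSumMax _)).trans (hD _ (length_segment η m n ω)).2)
    ((integrable_const _).add (h.integrable_sum_c m n))
    ((integrable_const _).add (h.integrable_sum_C m n))

lemma integrable_logMax (h : IsRandomProduct P η B M c C) (m n : ℕ) :
    Integrable (fun ω => Real.log (colSumMax (listProd M (segment η m n ω)))) P := by
  obtain ⟨D, D', hD⟩ := h.comparable.exists_log_colSum_bounds n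
  refine integrable_of_le_of_le
    (h.iid.measurable_segment (g := fun s => Real.log (colSumMax (listProd M s)))
      (h.measurable_logMax n) m).aestronglyMeasurable
    (ae_of_all _ fun ω => (hD _ (length_segment η m n ω)).1.trans
      (Real.log_le_log (h.comparable.colSumMin_listProd_pos _) (colSumMin_le_colSumMax _)))
    (ae_of_all _ fun ω => (hD _ (length_segment η m n ω)).2)
    ((integrable_const _).add (h.integrable_sum_c m n))
    ((integrable_const _).add (h.integrable_sum_C m n))

lemma integrable_logEntry (h : IsRandomProduct P η B M c C) {p : ℕ}
    (hp : ∀ l k, 0 < (B ^ p) l k) (m n : ℕ) (l k : ι) :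
    Integrable (fun ω => Real.log (listProd M (segment η m (p + n) ω) l k)) P := by
  obtain ⟨D, hD⟩ := h.comparable.exists_le_log_entry_append hp
  have hpos : ∀ ω, 0 < listProd M (segment η m (p + n) ω) l k := fun ω => by
    refine h.comparable.listProd_pos (fun a b => ?_) l k
    rw [length_segment]
    induction n generalizing a b with
    | zero => exact hp a b
    | succ n ih =>
      rw [← add_assoc, pow_succ, Matrix.mul_apply]
      obtain ⟨q, -, hq⟩ := Finset.exists_lt_of_sum_lt (s := Finset.univ)
        (f := fun _ : ι => (0 : ℝ)) (g := fun q => B q b) (by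
          simpa using (colSumMin_pos_of_isPrimitive h.comparable.prim).trans_le (colSumMin_le B b))
      exact Finset.sum_pos' (fun q _ => mul_nonneg (ih a q).le (h.comparable.prim.nonneg q b))
        ⟨q, Finset.mem_univ q, mul_pos (ih a q) hq⟩
  refine integrable_of_le_of_le
    ((h.iid.measurable_segment (g := fun s => listProd M s l k)
      (measurable_listProd_ofFn h.measurable (p + n) l k) m).log).aestronglyMeasurable
    (ae_of_all _ fun ω => ?_)
    (ae_of_all _ fun ω => Real.log_le_log (hpos ω)
      (entry_le_colSumMax (h.comparable.listProd_nonneg _) l k))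
    (((integrable_const D).add (h.integrable_sum_c m p)).add (h.integrable_logMin (m + p) n))
    (h.integrable_logMax m (p + n))
  have := hD (segment η m p ω) (segment η (m + p) n ω) l k (length_segment _ _ _ _)
  rwa [← segment_add] at this

/-- The rate at which the minimum and the maximum column sums of the random products grow. -/
theorem exists_rate (h : IsRandomProduct P η B M c C) : ∃ γ : ℝ,
    (∀ n : ℕ, ∫ ω, Real.log (colSumMin (listProd M (segment η 0 n ω))) ∂P ≤ γ * n) ∧
    (∀ n : ℕ, γ * n ≤ ∫ ω, Real.log (colSumMax (listProd M (segment η 0 n ω))) ∂P) ∧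
    Tendsto (fun n : ℕ => (∫ ω, Real.log (colSumMin (listProd M (segment η 0 n ω))) ∂P) / n)
      atTop (𝓝 γ) ∧
    Tendsto (fun n : ℕ => (∫ ω, Real.log (colSumMax (listProd M (segment η 0 n ω))) ∂P) / n)
      atTop (𝓝 γ) := by
  set a : ℕ → ℝ := fun n => ∫ ω, Real.log (colSumMax (listProd M (segment η 0 n ω))) ∂P
  set b : ℕ → ℝ := fun n => ∫ ω, Real.log (colSumMin (listProd M (segment η 0 n ω))) ∂P
  have ha0 : a 0 = 0 := by simp [a, colSumMax_one]
  have hb0 : b 0 = 0 := by simp [b, colSumMin_one]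
  have hsa : Subadditive a := by
    intro m n
    have e := (h.iid.identDistrib_segment (g := fun s => Real.log (colSumMax (listProd M s)))
      (h.measurable_logMax n) (0 + m)).integral_eq
    simp only [a]
    rw [← e, ← integral_add (h.integrable_logMax 0 m) (h.integrable_logMax (0 + m) n)]
    refine integral_mono (h.integrable_logMax 0 (m + n))
      ((h.integrable_logMax 0 m).add (h.integrable_logMax (0 + m) n)) fun ω => ?_
    simp only [segment_add]
    exact h.comparable.log_colSumMax_append_le _ _
  have hsb : Subadditive fun n => -b n := by
    intro m n
    have e := (h.iid.identDistrib_segment (g := fun s => Real.log (colSumMin (listProd M s)))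
      (h.measurable_logMin n) (0 + m)).integral_eq
    simp only [b]
    rw [← e, ← neg_add, neg_le_neg_iff,
      ← integral_add (h.integrable_logMin 0 m) (h.integrable_logMin (0 + m) n)]
    refine integral_mono ((h.integrable_logMin 0 m).add (h.integrable_logMin (0 + m) n))
      (h.integrable_logMin 0 (m + n)) fun ω => ?_
    simp only [segment_add]
    exact h.comparable.le_log_colSumMin_append _ _
  have hba : ∀ n, b n ≤ a n := fun n =>
    integral_mono (h.integrable_logMin 0 n) (h.integrable_logMax 0 n) fun ω =>
      Real.log_le_log (h.comparable.colSumMin_listProd_pos _) (colSumMin_le_colSumMax _)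
  have ha1 : ∀ n : ℕ, a n ≤ n * a 1 := by
    intro n
    have := hsa.apply_mul_add_le n 1 0
    simpa [ha0] using this
  have hb1 : ∀ n : ℕ, n * b 1 ≤ b n := by
    intro n
    have := hsb.apply_mul_add_le n 1 0
    simp only [mul_one, add_zero, hb0, neg_zero] at this
    linarith
  have hbdda : BddBelow (Set.range fun n : ℕ => a n / n) := by
    -- Superadditivity gives `n * b 1 ≤ b n ≤ a n`; the `0` covers `n = 0`, where the quotient is
    -- `0` by convention.
    refine ⟨min (b 1) 0, ?_⟩
    rintro _ ⟨n, rfl⟩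
    rcases Nat.eq_zero_or_pos n with rfl | hn
    · simp
    · refine (min_le_left _ _).trans ((le_div_iff₀ (by positivity)).2 ?_)
      rw [mul_comm]; exact (hb1 n).trans (hba n)
  have hbddb : BddBelow (Set.range fun n : ℕ => -b n / n) := by
    refine ⟨min (-a 1) 0, ?_⟩
    rintro _ ⟨n, rfl⟩
    rcases Nat.eq_zero_or_pos n with rfl | hn
    · simp
    · refine (min_le_left _ _).trans ((le_div_iff₀ (by positivity)).2 ?_)
      linarith [(hba n).trans (ha1 n)]
  have hta := hsa.tendsto_lim hbdda
  have htb := hsb.tendsto_lim hbddb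
  obtain ⟨p, hp0, hp⟩ := exists_forall_pow_pos h.comparable.prim
  obtain ⟨D, hD⟩ := h.comparable.exists_log_colSumMax_append_le (hp p le_rfl)
  -- The gap between the two logarithmic column sums is bounded by a function of the last `p`
  -- observations alone; `K` is its mean, the same for all `n`.
  set K : ℝ := p * ∫ ω, Real.log (C (η 0 ω)) ∂P - p * ∫ ω, Real.log (c (η 0 ω)) ∂P + D
  have hab : ∀ n, p ≤ n → a n ≤ b n + K := by
    intro n hn
    obtain ⟨q, rfl⟩ : ∃ q, n = q + p := ⟨n - p, by omega⟩
    have i1 := h.integrable_sum_C (0 + q) p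
    have i2 := h.integrable_sum_c (0 + q) p
    have e1 := h.iid.integral_sum_segment h.measurable_C.log h.integrable_C (0 + q) p
    have e2 := h.iid.integral_sum_segment h.measurable_c.log h.integrable_c (0 + q) p
    have i3 := h.integrable_logMin 0 (q + p)
    have i12 : Integrable (fun ω => ((segment η (0 + q) p ω).map fun x => Real.log (C x)).sum -
        ((segment η (0 + q) p ω).map fun x => Real.log (c x)).sum) P := i1.sub i2
    have i4 : Integrable (fun ω => ((segment η (0 + q) p ω).map fun x => Real.log (C x)).sum -
        ((segment η (0 + q) p ω).map fun x => Real.log (c x)).sum + D) P :=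
      i12.add (integrable_const D)
    have := integral_mono (h.integrable_logMax 0 (q + p)) (i3.add i4) fun ω => by
      have := hD (segment η 0 q ω) (segment η (0 + q) p ω) (length_segment _ _ _ _)
      rwa [← segment_add] at this
    refine this.trans (le_of_eq ?_)
    simp only [Pi.add_apply]
    rw [integral_add i3 i4, integral_add i12 (integrable_const D), integral_sub i1 i2, e1,
      e2]
    simp [b, K]
  have hlim : Tendsto (fun n : ℕ => b n / n) atTop (𝓝 hsa.lim) := by
    have hK : Tendsto (fun n : ℕ => a n / n - K / n) atTop (𝓝 hsa.lim) := by
      simpa using hta.sub (tendsto_const_div_atTop_nhds_zero_nat K)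
    refine tendsto_of_tendsto_of_tendsto_of_le_of_le' hK hta ?_ ?_
    · filter_upwards [eventually_ge_atTop p] with n hn
      rw [← sub_div]
      exact div_le_div_of_nonneg_right (by linarith [hab n hn]) (Nat.cast_nonneg n)
    · exact Eventually.of_forall fun n => div_le_div_of_nonneg_right (hba n) (Nat.cast_nonneg n)
  -- With the two Fekete limits identified, each one-sided bound by a limit becomes a bound by the
  -- same `γ`.
  have hγ : hsb.lim = -hsa.lim := by
    refine tendsto_nhds_unique htb ?_
    simpa only [neg_div] using hlim.neg
  refine ⟨hsa.lim, fun n => ?_, fun n => ?_, hlim, hta⟩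
  · rcases Nat.eq_zero_or_pos n with rfl | hn
    · simp [colSumMin_one]
    · have := hsb.lim_le_div hbddb hn.ne'
      rw [hγ, le_div_iff₀ (by positivity)] at this
      linarith
  · rcases Nat.eq_zero_or_pos n with rfl | hn
    · simp [colSumMax_one]
    · have := hsa.lim_le_div hbdda hn.ne'
      rwa [le_div_iff₀ (by positivity)] at this

/-- Growth of the random products, almost surely and in expectation. -/
theorem exists_isGrowthRate (h : IsRandomProduct P η B M c C) : ∃ γ : ℝ,
    IsGrowthRate P (fun n ω => listProd M (segment η 0 n ω)) γ ∧
    (∀ n : ℕ, ∫ ω, Real.log (colSumMin (listProd M (segment η 0 n ω))) ∂P ≤ γ * n) ∧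
    (∀ n : ℕ, γ * n ≤ ∫ ω, Real.log (colSumMax (listProd M (segment η 0 n ω))) ∂P) := by
  obtain ⟨γ, hmin, hmax, tmin, tmax⟩ := h.exists_rate
  obtain ⟨p, hp0, hp⟩ := exists_forall_pow_pos h.comparable.prim
  obtain ⟨D, hD⟩ := h.comparable.exists_le_log_entry_append (hp p le_rfl)
  have hpos : ∀ n, p ≤ n → ∀ ω l k, 0 < listProd M (segment η 0 n ω) l k := fun n hn ω l k =>
    h.comparable.listProd_pos (by rw [length_segment]; exact hp n hn) l k
  have hint : ∀ n, p ≤ n → ∀ l k,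
      Integrable (fun ω => Real.log (listProd M (segment η 0 n ω) l k)) P := by
    intro n hn l k
    obtain ⟨q, rfl⟩ : ∃ q, n = p + q := ⟨n - p, by omega⟩
    exact h.integrable_logEntry (hp p le_rfl) 0 q l k
  have entry_le : ∀ n, p ≤ n → ∀ ω l k, Real.log (listProd M (segment η 0 n ω) l k) ≤
      Real.log (colSumMax (listProd M (segment η 0 n ω))) := fun n hn ω l k =>
    Real.log_le_log (hpos n hn ω l k) (entry_le_colSumMax (h.comparable.listProd_nonneg _) l k)
  -- The first `p` factors form a positive matrix and are split off; the column sum is that of the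
  -- product starting at time `p`.
  have le_entry : ∀ n, p ≤ n → ∀ ω l k,
      D + ((segment η 0 p ω).map fun x => Real.log (c x)).sum +
        Real.log (colSumMin (listProd M (segment η p (n - p) ω))) ≤
      Real.log (listProd M (segment η 0 n ω) l k) := by
    intro n hn ω l k
    obtain ⟨q, rfl⟩ : ∃ q, n = p + q := ⟨n - p, by omega⟩
    rw [segment_add, zero_add, Nat.add_sub_cancel_left]
    exact hD _ _ l k (length_segment _ _ _ _)
  have aeup : ∀ᵐ ω ∂P, ∀ ε : ℝ, 0 < ε → ∀ᶠ n : ℕ in atTop,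
      Real.log (colSumMax (listProd M (segment η 0 n ω))) ≤ (γ + ε) * n := by
    -- The tolerance runs over the countable family `1 / (i + 1)`, so that one null set serves every
    -- `ε`. For each `i`, a block length `j` is chosen whose normalized mean is already below the
    -- tolerance.
    have : ∀ᵐ ω ∂P, ∀ i : ℕ, ∀ᶠ n : ℕ in atTop,
        Real.log (colSumMax (listProd M (segment η 0 n ω))) ≤ (γ + 1 / (i + 1)) * n := by
      refine ae_all_iff.2 fun i => ?_
      obtain ⟨j, hj, hj0⟩ := ((tmax.eventually_lt_const (u := γ + 1 / ((i : ℝ) + 1))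
        (lt_add_of_pos_right _ (by positivity))).and (eventually_gt_atTop 0)).exists
      rw [div_lt_iff₀ (by positivity)] at hj
      exact h.iid.eventually_le_of_subadditive
        (g := fun s => Real.log (colSumMax (listProd M s))) (by simp [colSumMax_one])
        h.comparable.log_colSumMax_append_le h.measurable_logMax (h.integrable_logMax 0) 0 hj0 hj
    filter_upwards [this] with ω hω ε hε
    obtain ⟨i, hi⟩ := exists_nat_one_div_lt hε
    filter_upwards [hω i] with n hn
    exact hn.trans (mul_le_mul_of_nonneg_right (by linarith) (Nat.cast_nonneg n))
  have aelo : ∀ᵐ ω ∂P, ∀ ε : ℝ, 0 < ε → ∀ᶠ n : ℕ in atTop,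
      (γ - ε) * n ≤ Real.log (colSumMin (listProd M (segment η p n ω))) := by
    -- The negated logarithm of the minimum column sum is subadditive, so the same block argument
    -- applies, now to segments starting at time `p`.
    have : ∀ᵐ ω ∂P, ∀ i : ℕ, ∀ᶠ n : ℕ in atTop,
        -Real.log (colSumMin (listProd M (segment η p n ω))) ≤ (-γ + 1 / (i + 1)) * n := by
      refine ae_all_iff.2 fun i => ?_
      obtain ⟨j, hj, hj0⟩ := ((tmin.eventually_const_lt (u := γ - 1 / ((i : ℝ) + 1))
        (sub_lt_self _ (by positivity))).and (eventually_gt_atTop 0)).exists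
      rw [lt_div_iff₀ (by positivity)] at hj
      refine h.iid.eventually_le_of_subadditive
        (g := fun s => -Real.log (colSumMin (listProd M s))) (by simp [colSumMin_one])
        (fun a b => ?_) (fun n => (h.measurable_logMin n).neg)
        (fun n => (h.integrable_logMin 0 n).neg) p hj0 ?_
      · linarith [h.comparable.le_log_colSumMin_append a b]
      · rw [integral_neg]; linarith
    filter_upwards [this] with ω hω ε hε
    obtain ⟨i, hi⟩ := exists_nat_one_div_lt hε
    filter_upwards [hω i] with n hn
    have := mul_le_mul_of_nonneg_right (a := (n : ℝ)) hi.le (Nat.cast_nonneg n)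
    linarith
  have hp_tendsto : Tendsto (fun n : ℕ => n - p) atTop atTop := tendsto_sub_atTop_nat p
  refine ⟨γ, ⟨?_, ?_, fun l k => ?_, fun l k => ?_⟩, hmin, hmax⟩
  · filter_upwards [eventually_ge_atTop p] with n hn
    exact ae_of_all _ (hpos n hn)
  · filter_upwards [eventually_ge_atTop p] with n hn
    exact hint n hn
  · filter_upwards [aeup, aelo] with ω hup hlo
    refine tendsto_one_div_mul_of_eventually (fun ε hε => ?_) (fun ε hε => ?_)
    · set K := D + ((segment η 0 p ω).map fun x => Real.log (c x)).sum
      -- For fixed `ω`, the split-off prefix and the shift from `n - p` to `n` cost a constant,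
      -- absorbed by half of the tolerance.
      have hK : ∀ᶠ n : ℕ in atTop, (γ - ε / 2) * p - K ≤ ε / 2 * n :=
        (tendsto_natCast_atTop_atTop.const_mul_atTop (by positivity)).eventually_ge_atTop _
      filter_upwards [hp_tendsto.eventually (hlo (ε / 2) (by positivity)), hK,
        eventually_ge_atTop p] with n h1 h2 hn
      have h3 := le_entry n hn ω l k
      rw [Nat.cast_sub hn] at h1
      nlinarith
    · filter_upwards [hup ε hε, eventually_ge_atTop p] with n h1 hn
      exact (entry_le n hn ω l k).trans h1
  · simp only [one_div_mul_eq_div]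
    set K := D + p * ∫ ω, Real.log (c (η 0 ω)) ∂P
    have hlo : ∀ n, p ≤ n →
        K + ∫ ω, Real.log (colSumMin (listProd M (segment η 0 (n - p) ω))) ∂P ≤
        ∫ ω, Real.log (listProd M (segment η 0 n ω) l k) ∂P := by
      intro n hn
      have i1 := h.integrable_sum_c 0 p
      have i2 := h.integrable_logMin p (n - p)
      have e1 := h.iid.integral_sum_segment h.measurable_c.log h.integrable_c 0 p
      have e2 := (h.iid.identDistrib_segment (g := fun s => Real.log (colSumMin (listProd M s)))
        (h.measurable_logMin (n - p)) p).integral_eq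
      have i3 : Integrable (fun ω => D + ((segment η 0 p ω).map fun x => Real.log (c x)).sum) P :=
        (integrable_const D).add i1
      refine (le_of_eq ?_).trans (integral_mono (i3.add i2) (hint n hn l k)
        fun ω => le_entry n hn ω l k)
      simp only [Pi.add_apply]
      rw [integral_add i3 i2, integral_add (integrable_const D) i1, e1, e2]
      simp [K]
    clear_value K
    have hlim : Tendsto (fun n : ℕ => (K +
        ∫ ω, Real.log (colSumMin (listProd M (segment η 0 (n - p) ω))) ∂P) / n) atTop (𝓝 γ) := by
      have h1 : Tendsto (fun n : ℕ => ((n - p : ℕ) : ℝ) / n) atTop (𝓝 1) := by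
        have : Tendsto (fun n : ℕ => 1 - (p : ℝ) / n) atTop (𝓝 1) := by
          simpa using tendsto_const_nhds.sub (tendsto_const_div_atTop_nhds_zero_nat (p : ℝ))
        refine this.congr' ?_
        filter_upwards [eventually_ge_atTop p, eventually_gt_atTop 0] with n hn hn0
        have : (n : ℝ) ≠ 0 := by positivity
        rw [Nat.cast_sub hn]
        field_simp
      have h2 := (tendsto_const_div_atTop_nhds_zero_nat K).add ((tmin.comp hp_tendsto).mul h1)
      rw [zero_add, mul_one] at h2
      refine h2.congr' ?_
      filter_upwards [hp_tendsto.eventually_gt_atTop 0] with n hn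
      have : ((n - p : ℕ) : ℝ) ≠ 0 := by positivity
      simp only [Function.comp]
      rw [add_div]
      congr 1
      field_simp
    refine tendsto_of_tendsto_of_tendsto_of_le_of_le' hlim tmax ?_ ?_
    · filter_upwards [eventually_ge_atTop p] with n hn
      exact div_le_div_of_nonneg_right (hlo n hn) (Nat.cast_nonneg n)
    · filter_upwards [eventually_ge_atTop p] with n hn
      exact div_le_div_of_nonneg_right (integral_mono (hint n hn l k) (h.integrable_logMax 0 n)
        fun ω => entry_le n hn ω l k) (Nat.cast_nonneg n)

end IsRandomProduct

end GrowthRate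

/-! ### Density ratios and the Kullback–Leibler divergence -/

section DensityRatio

variable {S : Type*} [MeasurableSpace S] {ν : Measure S} {f g : S → ℝ}

lemma ae_lawOf_pos (hf : Measurable f) : ∀ᵐ x ∂lawOf ν f, 0 < f x := by
  rw [lawOf, ae_withDensity_iff hf.ennreal_ofReal]
  exact ae_of_all _ fun x hx => by simpa using hx

/-- Multiplying the ratio by `f` gives back `g` where `f` is positive. Only an inequality holds,
since the mass of `g` on the set where `f` vanishes is lost. -/
lemma lintegral_ratio_le (hf : Measurable f) (hg : Measurable g)
    [IsProbabilityMeasure (lawOf ν g)] :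
    ∫⁻ x, ENNReal.ofReal (g x / f x) ∂lawOf ν f ≤ 1 := by
  rw [lawOf, lintegral_withDensity_eq_lintegral_mul _ hf.ennreal_ofReal
    (show Measurable fun x => ENNReal.ofReal (g x / f x) from (hg.div hf).ennreal_ofReal)]
  calc _ ≤ ∫⁻ x, ENNReal.ofReal (g x) ∂ν := by
        refine lintegral_mono fun x => ?_
        simp only [Pi.mul_apply]
        rcases le_or_gt (f x) 0 with h | h
        · simp [ENNReal.ofReal_of_nonpos h]
        · rw [← ENNReal.ofReal_mul h.le, mul_div_cancel₀ _ h.ne']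
    _ = lawOf ν g Set.univ := by rw [lawOf, withDensity_apply _ MeasurableSet.univ]; simp
    _ = 1 := measure_univ
    _ ≤ 1 := le_rfl

lemma integrable_ratio (hf : Measurable f) (hg : Measurable g) (hf0 : ∀ x, 0 ≤ f x)
    (hg0 : ∀ x, 0 ≤ g x) [IsProbabilityMeasure (lawOf ν g)] :
    Integrable (fun x => g x / f x) (lawOf ν f) ∧ ∫ x, g x / f x ∂lawOf ν f ≤ 1 := by
  have h0 : ∀ x, 0 ≤ g x / f x := fun x => div_nonneg (hg0 x) (hf0 x)
  have hle := lintegral_ratio_le (ν := ν) hf hg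
  have hm : AEStronglyMeasurable (fun x => g x / f x) (lawOf ν f) :=
    (hg.div hf).aestronglyMeasurable
  refine ⟨(lintegral_ofReal_ne_top_iff_integrable hm (ae_of_all _ h0)).1
    (hle.trans_lt ENNReal.one_lt_top).ne, ?_⟩
  rw [integral_eq_lintegral_of_nonneg_ae (ae_of_all _ h0) hm]
  exact ENNReal.toReal_le_of_le_ofReal zero_le_one (by simpa using hle)

/-- Finite divergence includes absolute continuity, and `g` is positive almost everywhere under its
own law. -/
lemma ae_pos_of_klDiv_lt_top (hg : Measurable g)
    (hkl : InformationTheory.klDiv (lawOf ν f) (lawOf ν g) < ⊤) :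
    ∀ᵐ x ∂lawOf ν f, 0 < g x :=
  (InformationTheory.klDiv_ne_top_iff.1 hkl.ne).1.ae_le (ae_lawOf_pos hg)

lemma lawOf_eq_withDensity_ratio (hf : Measurable f) (hg : Measurable g)
    (hpos : ∀ᵐ x ∂lawOf ν f, 0 < g x) :
    lawOf ν f = (lawOf ν g).withDensity fun x => ENNReal.ofReal (f x / g x) := by
  have hm : Measurable fun x => ENNReal.ofReal (f x / g x) := (hf.div hg).ennreal_ofReal
  rw [lawOf, lawOf, ← withDensity_mul _ hg.ennreal_ofReal hm]
  rw [lawOf, ae_withDensity_iff hf.ennreal_ofReal] at hpos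
  refine withDensity_congr_ae ?_
  filter_upwards [hpos] with x hx
  simp only [Pi.mul_apply]
  rcases eq_or_ne (ENNReal.ofReal (f x)) 0 with h | h
  · have : f x / g x ≤ 0 ∨ g x ≤ 0 := by
      rw [ENNReal.ofReal_eq_zero] at h
      rcases le_or_gt (g x) 0 with h' | h'
      · exact Or.inr h'
      · exact Or.inl (div_nonpos_of_nonpos_of_nonneg h h'.le)
    rcases this with h' | h' <;> simp [h, ENNReal.ofReal_of_nonpos h']
  · rw [← ENNReal.ofReal_mul (hx h).le, mul_div_cancel₀ _ (hx h).ne']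

/-- The Radon–Nikodym derivative is `f / g`, so the log-likelihood ratio is `-log (g / f)`. The mass
correction in `klDiv` vanishes since both measures are probabilities. -/
lemma integrable_log_ratio (hf : Measurable f) (hg : Measurable g)
    [IsProbabilityMeasure (lawOf ν f)] [IsProbabilityMeasure (lawOf ν g)]
    (hkl : InformationTheory.klDiv (lawOf ν f) (lawOf ν g) < ⊤) :
    Integrable (fun x => Real.log (g x / f x)) (lawOf ν f) ∧
      ∫ x, Real.log (g x / f x) ∂lawOf ν f =
        -(InformationTheory.klDiv (lawOf ν f) (lawOf ν g)).toReal := by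
  obtain ⟨hac, hint⟩ := InformationTheory.klDiv_ne_top_iff.1 hkl.ne
  have hpos := ae_pos_of_klDiv_lt_top hg hkl
  have hrn : (lawOf ν f).rnDeriv (lawOf ν g) =ᵐ[lawOf ν f]
      fun x => ENNReal.ofReal (f x / g x) := by
    refine hac.ae_le ?_
    have hm : Measurable fun x => ENNReal.ofReal (f x / g x) := (hf.div hg).ennreal_ofReal
    have := Measure.rnDeriv_withDensity (lawOf ν g) hm
    rwa [← lawOf_eq_withDensity_ratio hf hg hpos] at this
  have hae : (fun x => -Real.log (g x / f x)) =ᵐ[lawOf ν f] llr (lawOf ν f) (lawOf ν g) := by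
    filter_upwards [hrn, hpos, ae_lawOf_pos (ν := ν) hf] with x hx hgx hfx
    rw [llr, hx, ENNReal.toReal_ofReal (div_pos hfx hgx).le, ← Real.log_inv, inv_div]
  have h1 := (integrable_congr hae).2 hint
  refine ⟨by simpa using h1.neg, ?_⟩
  rw [InformationTheory.toReal_klDiv_of_measure_eq hac (by simp), ← integral_congr_ae hae,
    integral_neg, neg_neg]

end DensityRatio

/-! ### Likelihood ratios of the signals -/

section Signals

variable {ι Θ Ω : Type*} [Fintype ι] [DecidableEq ι] [Nonempty ι] {X : ι → Type*}
  [∀ k, MeasurableSpace (X k)]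

/-- The likelihood ratio, replaced by `1` where it fails to be positive. -/
noncomputable def posRatio (L : ∀ k, Θ → X k → ℝ) (θ₀ θ : Θ) (x : ∀ k, X k) (k : ι) : ℝ :=
  if 0 < likelihoodRatio L θ₀ θ x k then likelihoodRatio L θ₀ θ x k else 1

variable {L : ∀ k, Θ → X k → ℝ} {θ₀ θ : Θ}

omit [Fintype ι] [DecidableEq ι] [Nonempty ι] [∀ k, MeasurableSpace (X k)] in
lemma posRatio_pos (x : ∀ k, X k) (k : ι) : 0 < posRatio L θ₀ θ x k := by
  unfold posRatio; split_ifs with h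
  · exact h
  · exact one_pos

omit [Fintype ι] [DecidableEq ι] [Nonempty ι] [∀ k, MeasurableSpace (X k)] in
-- The modification is almost surely invisible; it makes the pointwise bounds of `IsComparable` hold
-- at every `x`, not only almost everywhere.
lemma posRatio_eq {x : ∀ k, X k} (h : ∀ k, 0 < likelihoodRatio L θ₀ θ x k) :
    posRatio L θ₀ θ x = likelihoodRatio L θ₀ θ x := by
  funext k; exact if_pos (h k)

omit [Fintype ι] [DecidableEq ι] [Nonempty ι] in
lemma measurable_likelihoodRatio (hL : ∀ k θ, Measurable (L k θ)) (θ₀ θ : Θ) (k : ι) :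
    Measurable fun x : ∀ k, X k => likelihoodRatio L θ₀ θ x k :=
  ((hL k θ).comp (measurable_pi_apply k)).div ((hL k θ₀).comp (measurable_pi_apply k))

omit [Fintype ι] [DecidableEq ι] [Nonempty ι] in
lemma measurable_posRatio (hL : ∀ k θ, Measurable (L k θ)) (θ₀ θ : Θ) (k : ι) :
    Measurable fun x : ∀ k, X k => posRatio L θ₀ θ x k := by
  have h := measurable_likelihoodRatio hL θ₀ θ k
  exact Measurable.ite (measurableSet_lt measurable_const h) h measurable_const

/-- Signals that are i.i.d. over time and whose likelihood ratios have the properties that follow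
from finite Kullback–Leibler divergences `D k θ` to the true hypothesis `θ₀`. -/
structure IsSignal [MeasurableSpace Ω] (P : Measure Ω) (ξ : ℕ → Ω → ∀ k, X k)
    (L : ∀ k, Θ → X k → ℝ) (θ₀ : Θ) (D : ι → Θ → ℝ) : Prop where
  iid : IsIID P ξ
  measurable : ∀ k θ, Measurable (L k θ)
  ae_pos : ∀ᵐ ω ∂P, ∀ i k θ, 0 < L k θ (ξ i ω k)
  integrable : ∀ i k θ, Integrable (fun ω => likelihoodRatio L θ₀ θ (ξ i ω) k) P
  integral_le : ∀ i k θ, ∫ ω, likelihoodRatio L θ₀ θ (ξ i ω) k ∂P ≤ 1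
  integrable_log : ∀ i k θ, Integrable (fun ω => Real.log (likelihoodRatio L θ₀ θ (ξ i ω) k)) P
  integral_log : ∀ i k θ, ∫ ω, Real.log (likelihoodRatio L θ₀ θ (ξ i ω) k) ∂P = -D k θ

omit [DecidableEq ι] [Nonempty ι] in
lemma isSignal_of_klDiv_lt_top [Fintype Θ] [MeasurableSpace Ω] {P : Measure Ω}
    {ν : ∀ k, Measure (X k)}
    (hL_meas : ∀ k θ, Measurable (L k θ)) (hL_nonneg : ∀ k θ x, 0 ≤ L k θ x)
    (hL_prob : ∀ k θ, IsProbabilityMeasure (lawOf (ν k) (L k θ)))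
    {ξ : ℕ → Ω → ∀ k, X k} (hξ : IsIID P ξ)
    (hξ_law : ∀ i k, P.map (fun ω => ξ i ω k) = lawOf (ν k) (L k θ₀))
    (hKL : ∀ k θ,
      InformationTheory.klDiv (lawOf (ν k) (L k θ₀)) (lawOf (ν k) (L k θ)) < ⊤) :
    IsSignal P ξ L θ₀ fun k θ =>
      (InformationTheory.klDiv (lawOf (ν k) (L k θ₀)) (lawOf (ν k) (L k θ))).toReal := by
  have hm : ∀ i k, Measurable fun ω => ξ i ω k := fun i k =>
    (measurable_pi_apply k).comp (hξ.measurable i)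
  have hr : ∀ k θ, Measurable fun x => L k θ x / L k θ₀ x := fun k θ =>
    (hL_meas k θ).div (hL_meas k θ₀)
  refine ⟨hξ, hL_meas, ?_, fun i k θ => ?_, fun i k θ => ?_, fun i k θ => ?_, fun i k θ => ?_⟩
  · refine ae_all_iff.2 fun i => ae_all_iff.2 fun k => ae_all_iff.2 fun θ => ?_
    refine ae_of_ae_map (hm i k).aemeasurable (p := fun x => 0 < L k θ x) ?_
    rw [hξ_law]
    exact ae_pos_of_klDiv_lt_top (hL_meas k θ) (hKL k θ)
  · have := (integrable_ratio (ν := ν k) (hL_meas k θ₀) (hL_meas k θ) (hL_nonneg k θ₀)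
      (hL_nonneg k θ)).1
    rw [← hξ_law i] at this
    exact this.comp_measurable (hm i k)
  · have := (integrable_ratio (ν := ν k) (hL_meas k θ₀) (hL_meas k θ) (hL_nonneg k θ₀)
      (hL_nonneg k θ)).2
    rwa [← hξ_law i, integral_map (hm i k).aemeasurable (hr k θ).aestronglyMeasurable] at this
  · have := (integrable_log_ratio (hL_meas k θ₀) (hL_meas k θ) (hKL k θ)).1
    rw [← hξ_law i] at this
    exact this.comp_measurable (hm i k)
  · have := (integrable_log_ratio (hL_meas k θ₀) (hL_meas k θ) (hKL k θ)).2
    rwa [← hξ_law i, integral_map (hm i k).aemeasurable (hr k θ).log.aestronglyMeasurable,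
      hξ_law i] at this

variable [MeasurableSpace Ω] {P : Measure Ω} {ξ : ℕ → Ω → ∀ k, X k} {D : ι → Θ → ℝ}

omit [DecidableEq ι] [Nonempty ι] [Fintype ι] in
lemma IsSignal.ae_ratio_pos (h : IsSignal P ξ L θ₀ D) :
    ∀ᵐ ω ∂P, ∀ i k θ, 0 < likelihoodRatio L θ₀ θ (ξ i ω) k := by
  filter_upwards [h.ae_pos] with ω hω i k θ
  exact div_pos (hω i k θ) (hω i k θ₀)

omit [DecidableEq ι] [Nonempty ι] [Fintype ι] in
lemma IsSignal.integrable_log_posRatio (h : IsSignal P ξ L θ₀ D) (i : ℕ) (k : ι) (θ : Θ) :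
    Integrable (fun ω => Real.log (posRatio L θ₀ θ (ξ i ω) k)) P := by
  refine (integrable_congr ?_).1 (h.integrable_log i k θ)
  filter_upwards [h.ae_ratio_pos] with ω hω
  rw [posRatio_eq fun k => hω i k θ]

/-- Least positive ratio over the agents. -/
noncomputable def minRatio (L : ∀ k, Θ → X k → ℝ) (θ₀ θ : Θ) (x : ∀ k, X k) : ℝ :=
  Finset.univ.inf' Finset.univ_nonempty (posRatio L θ₀ θ x)

/-- Greatest positive ratio over the agents. -/
noncomputable def maxRatio (L : ∀ k, Θ → X k → ℝ) (θ₀ θ : Θ) (x : ∀ k, X k) : ℝ :=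
  Finset.univ.sup' Finset.univ_nonempty (posRatio L θ₀ θ x)

/-- The random matrix `Aᵀ R` with positive ratios. -/
noncomputable def ratioMatrix (A : Matrix ι ι ℝ) (L : ∀ k, Θ → X k → ℝ) (θ₀ θ : Θ)
    (x : ∀ k, X k) : Matrix ι ι ℝ :=
  Aᵀ * Matrix.diagonal (posRatio L θ₀ θ x)

omit [Nonempty ι] [∀ k, MeasurableSpace (X k)] in
lemma ratioMatrix_apply (A : Matrix ι ι ℝ) (x : ∀ k, X k) (l k : ι) :
    ratioMatrix A L θ₀ θ x l k = A k l * posRatio L θ₀ θ x k := by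
  rw [ratioMatrix, Matrix.mul_diagonal, Matrix.transpose_apply]

omit [DecidableEq ι] [Nonempty ι] in
-- Whichever agent is selected, the absolute logarithm is at most the sum over all agents, so no
-- independence across agents is needed.
lemma IsSignal.integrable_log_of_mem (h : IsSignal P ξ L θ₀ D) (θ : Θ) {c : (∀ k, X k) → ℝ}
    (hc : Measurable c) (hmem : ∀ x, ∃ k, c x = posRatio L θ₀ θ x k) :
    Integrable (fun ω => Real.log (c (ξ 0 ω))) P := by
  refine Integrable.mono' (integrable_finsetSum Finset.univ fun k _ =>
    (h.integrable_log_posRatio 0 k θ).abs) (hc.comp (h.iid.measurable 0)).log.aestronglyMeasurable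
    (ae_of_all _ fun ω => ?_)
  obtain ⟨k, hk⟩ := hmem (ξ 0 ω)
  rw [hk, Real.norm_eq_abs]
  exact Finset.single_le_sum (f := fun k => |Real.log (posRatio L θ₀ θ (ξ 0 ω) k)|)
    (fun _ _ => abs_nonneg _) (Finset.mem_univ k)

omit [DecidableEq ι] [∀ k, MeasurableSpace (X k)] in
lemma minRatio_le (x : ∀ k, X k) (k : ι) : minRatio L θ₀ θ x ≤ posRatio L θ₀ θ x k :=
  Finset.inf'_le _ (Finset.mem_univ k)

omit [DecidableEq ι] [∀ k, MeasurableSpace (X k)] in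
lemma le_maxRatio (x : ∀ k, X k) (k : ι) : posRatio L θ₀ θ x k ≤ maxRatio L θ₀ θ x :=
  Finset.le_sup' _ (Finset.mem_univ k)

omit [DecidableEq ι] [∀ k, MeasurableSpace (X k)] in
lemma minRatio_pos (x : ∀ k, X k) : 0 < minRatio L θ₀ θ x :=
  (Finset.lt_inf'_iff _).2 fun k _ => posRatio_pos x k

omit [DecidableEq ι] [∀ k, MeasurableSpace (X k)] in
lemma maxRatio_pos (x : ∀ k, X k) : 0 < maxRatio L θ₀ θ x :=
  (posRatio_pos x (Classical.arbitrary ι)).trans_le (le_maxRatio x _)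

omit [DecidableEq ι] in
lemma measurable_minRatio (hL : ∀ k θ, Measurable (L k θ)) :
    Measurable (minRatio L θ₀ θ : (∀ k, X k) → ℝ) := by
  have := Finset.inf'_induction (Finset.univ_nonempty (α := ι))
    (fun k (x : ∀ k, X k) => posRatio L θ₀ θ x k)
    (p := Measurable) (fun _ h₁ _ h₂ => h₁.inf h₂) fun k _ => measurable_posRatio hL θ₀ θ k
  convert this using 1
  ext x
  rw [Finset.inf'_apply]; rfl

omit [DecidableEq ι] in
lemma measurable_maxRatio (hL : ∀ k θ, Measurable (L k θ)) :
    Measurable (maxRatio L θ₀ θ : (∀ k, X k) → ℝ) := by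
  have := Finset.measurable_sup' (Finset.univ_nonempty (α := ι))
    (f := fun k (x : ∀ k, X k) => posRatio L θ₀ θ x k) fun k _ => measurable_posRatio hL θ₀ θ k
  convert this using 1
  ext x
  rw [Finset.sup'_apply]; rfl

omit [DecidableEq ι] in
lemma IsSignal.integrable_log_minRatio (h : IsSignal P ξ L θ₀ D) (θ : Θ) :
    Integrable (fun ω => Real.log (minRatio L θ₀ θ (ξ 0 ω))) P :=
  h.integrable_log_of_mem θ (measurable_minRatio h.measurable) fun x =>
    let ⟨k, _, hk⟩ := Finset.exists_mem_eq_inf' Finset.univ_nonempty (posRatio L θ₀ θ x)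
    ⟨k, hk⟩

omit [DecidableEq ι] in
lemma IsSignal.integrable_log_maxRatio (h : IsSignal P ξ L θ₀ D) (θ : Θ) :
    Integrable (fun ω => Real.log (maxRatio L θ₀ θ (ξ 0 ω))) P :=
  h.integrable_log_of_mem θ (measurable_maxRatio h.measurable) fun x =>
    let ⟨k, _, hk⟩ := Finset.exists_mem_eq_sup' Finset.univ_nonempty (posRatio L θ₀ θ x)
    ⟨k, hk⟩

lemma IsSignal.isRandomProduct (h : IsSignal P ξ L θ₀ D) {A : Matrix ι ι ℝ}
    (hA : A.IsPrimitive) (θ : Θ) :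
    IsRandomProduct P ξ Aᵀ (ratioMatrix A L θ₀ θ) (minRatio L θ₀ θ) (maxRatio L θ₀ θ) where
  iid := h.iid
  comparable :=
    { prim := isPrimitive_transpose hA
      c_pos := minRatio_pos
      C_pos := maxRatio_pos
      lower := fun x l k => by
        rw [ratioMatrix_apply, Matrix.transpose_apply, mul_comm]
        exact mul_le_mul_of_nonneg_left (minRatio_le x k) (hA.nonneg k l)
      upper := fun x l k => by
        rw [ratioMatrix_apply, Matrix.transpose_apply, mul_comm (maxRatio _ _ _ _)]
        exact mul_le_mul_of_nonneg_left (le_maxRatio x k) (hA.nonneg k l) }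
  measurable l k := by
    simp only [ratioMatrix_apply]
    exact (measurable_posRatio h.measurable θ₀ θ k).const_mul _
  measurable_c := measurable_minRatio h.measurable
  measurable_C := measurable_maxRatio h.measurable
  integrable_c := h.integrable_log_minRatio θ
  integrable_C := h.integrable_log_maxRatio θ

end Signals

/-! ### Reversing the order of the factors -/

section Reversal

variable {ι E Ω : Type*} [Fintype ι] [DecidableEq ι] [Nonempty ι]

omit [Nonempty ι] in
lemma IsComparable.transpose {B : Matrix ι ι ℝ} {M : E → Matrix ι ι ℝ} {c C : E → ℝ}
    (h : IsComparable B M c C) : IsComparable Bᵀ (fun x => (M x)ᵀ) c C where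
  prim := isPrimitive_transpose h.prim
  c_pos := h.c_pos
  C_pos := h.C_pos
  lower x l k := h.lower x k l
  upper x l k := h.upper x k l

omit [Nonempty ι] in
lemma listProd_transpose (M : E → Matrix ι ι ℝ) (s : List E) :
    listProd (fun x => (M x)ᵀ) s = (listProd M s.reverse)ᵀ := by
  induction s with
  | nil => simp
  | cons x s ih =>
    rw [listProd_cons, List.reverse_cons, listProd_append, Matrix.transpose_mul, ih, listProd_cons,
      listProd_nil, mul_one]

variable [MeasurableSpace E] [MeasurableSpace Ω] {P : Measure Ω} [IsProbabilityMeasure P]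
  {η : ℕ → Ω → E} {B : Matrix ι ι ℝ} {M : E → Matrix ι ι ℝ} {c C : E → ℝ}

omit [Nonempty ι] [IsProbabilityMeasure P] in
lemma IsRandomProduct.transpose (h : IsRandomProduct P η B M c C) :
    IsRandomProduct P η Bᵀ (fun x => (M x)ᵀ) c C where
  iid := h.iid
  comparable := h.comparable.transpose
  measurable l k := h.measurable k l
  measurable_c := h.measurable_c
  measurable_C := h.measurable_C
  integrable_c := h.integrable_c
  integrable_C := h.integrable_C

/-- A growth rate of the products in one order is a growth rate of those in the reverse order. -/
theorem IsRandomProduct.isGrowthRate_reverse (h : IsRandomProduct P η B M c C) {γ : ℝ}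
    (hγ : IsGrowthRate P (fun n ω => listProd M (segment η 0 n ω)) γ) :
    IsGrowthRate P (fun n ω => listProd M (segment η 0 n ω).reverse) γ := by
  -- The transposed factors satisfy the same hypotheses, so the reversed products have some rate
  -- `γ'`.
  obtain ⟨γ', h', -, -⟩ := h.transpose.exists_isGrowthRate
  simp only [listProd_transpose] at h'
  -- Forward and reversed products differ pathwise, but an i.i.d. segment and its reversal have the
  -- same law. The rates are therefore compared through expectations.
  have e : ∀ n l k, ∫ ω, Real.log (listProd M (segment η 0 n ω).reverse l k) ∂P =
      ∫ ω, Real.log (listProd M (segment η 0 n ω) l k) ∂P := by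
    intro n l k
    have := ((h.iid.identDistrib_tuple (σ := fun i : Fin n => 0 + Fin.rev i)
      (τ := fun i : Fin n => 0 + i)
      (fun a b hab => Fin.rev_injective (Fin.ext (Nat.add_left_cancel hab)))
      (fun a b hab => Fin.ext (Nat.add_left_cancel hab))).comp
      (measurable_listProd_ofFn h.measurable n l k).log).integral_eq
    have hrev : ∀ ω, (segment η 0 n ω).reverse =
        List.ofFn fun i : Fin n => η (0 + Fin.rev i) ω := fun ω => by
      refine List.ext_getElem (by simp [segment]) fun i h₁ h₂ => ?_
      simp [segment, Fin.rev]
      congr 1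
      omega
    simp only [hrev]
    exact this
  have heq : γ' = γ := by
    let k := Classical.arbitrary ι
    refine tendsto_nhds_unique (h'.tendsto_integral k k) ?_
    simpa only [Matrix.transpose_apply, e] using hγ.tendsto_integral k k
  subst heq
  exact ⟨h'.eventually_pos.mono fun n hn => hn.mono fun ω hω l k => hω k l,
    h'.eventually_integrable.mono fun n hn l k => hn k l,
    fun l k => h'.tendsto_ae k l, fun l k => h'.tendsto_integral k l⟩

end Reversal

/-! ### A positive fixed vector of the combination matrix -/

section Perron

variable {ι : Type*} [Fintype ι] [DecidableEq ι] [Nonempty ι]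

/-- A primitive matrix whose columns sum to one has a positive fixed vector. -/
lemma exists_pos_fixed_vector {A : Matrix ι ι ℝ} (hA : A.IsPrimitive)
    (hA_stoch : ∀ k, ∑ l, A l k = 1) :
    ∃ π : ι → ℝ, (∀ k, 0 < π k) ∧ ∀ l, ∑ k, A l k * π k = π l := by
  -- Unit column sums make the constant vector a left fixed vector, so `A - 1` is singular and has a
  -- right kernel vector `v`.
  have hdet : (A - 1).det = 0 := by
    refine Matrix.exists_vecMul_eq_zero_iff.1 ⟨fun _ => 1, fun h => ?_, ?_⟩
    · exact one_ne_zero (congrFun h (Classical.arbitrary ι))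
    · funext k
      simp [Matrix.vecMul, dotProduct, Matrix.sub_apply, hA_stoch, Matrix.one_apply]
  obtain ⟨v, hv0, hv⟩ := Matrix.exists_mulVec_eq_zero_iff.2 hdet
  have hv' : ∀ l, ∑ k, A l k * v k = v l := by
    intro l
    have := congrFun hv l
    rw [Matrix.sub_mulVec, Matrix.one_mulVec, Pi.sub_apply, Pi.zero_apply, sub_eq_zero] at this
    exact this
  have hle : ∀ l ∈ Finset.univ, |v l| ≤ ∑ k, A l k * |v k| := by
    intro l _
    conv_lhs => rw [← hv' l]
    refine (Finset.abs_sum_le_sum_abs _ _).trans (le_of_eq (Finset.sum_congr rfl fun k _ => ?_))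
    rw [abs_mul, abs_of_nonneg (hA.nonneg l k)]
  -- Entrywise `|v| ≤ A |v|`, and `A` preserves the total, so equality holds in every entry.
  have hsum : ∑ l, |v l| = ∑ l, ∑ k, A l k * |v k| := by
    rw [Finset.sum_comm]
    refine Finset.sum_congr rfl fun k _ => ?_
    rw [← Finset.sum_mul, hA_stoch, one_mul]
  have hfix : ∀ l, ∑ k, A l k * |v k| = |v l| := fun l =>
    ((Finset.sum_eq_sum_iff_of_le hle).1 hsum l (Finset.mem_univ l)).symm
  obtain ⟨p, -, hp⟩ := hA.exists_pos_pow
  have hpow : ∀ n : ℕ, (A ^ n) *ᵥ (fun k => |v k|) = fun k => |v k| := by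
    intro n
    induction n with
    | zero => rw [pow_zero, Matrix.one_mulVec]
    | succ n ih =>
      rw [pow_succ, ← Matrix.mulVec_mulVec]
      have : A *ᵥ (fun k => |v k|) = fun k => |v k| := funext hfix
      rw [this, ih]
  obtain ⟨k₀, hk₀⟩ := Function.ne_iff.1 hv0
  refine ⟨fun k => |v k|, fun l => ?_, hfix⟩
  refine lt_of_lt_of_eq ?_ (congrFun (hpow p) l)
  exact Finset.sum_pos' (fun k _ => mul_nonneg (hp l k).le (abs_nonneg _))
    ⟨k₀, Finset.mem_univ _, mul_pos (hp l k₀) (abs_pos.2 hk₀)⟩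

end Perron

/-! ### Beliefs, predictive densities and the linear recursion -/

section Belief

variable {ι Θ Ω : Type*} [Fintype ι] [Fintype Θ] {X : ι → Type*}

/-- Predictive density of agent `l` at the observation, relative to the density under `θ₀`. -/
noncomputable def predictive (L : ∀ k, Θ → X k → ℝ) (θ₀ : Θ) (μ : ι → Θ → ℝ) (x : ∀ k, X k)
    (l : ι) : ℝ :=
  ∑ θ, likelihoodRatio L θ₀ θ x l * μ l θ

/-- Sum of all likelihood ratios. -/
noncomputable def totalRatio (L : ∀ k, Θ → X k → ℝ) (θ₀ : Θ) (x : ∀ k, X k) : ℝ :=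
  ∑ l, ∑ θ, likelihoodRatio L θ₀ θ x l

variable {L : ∀ k, Θ → X k → ℝ} {θ₀ : Θ} {A : Matrix ι ι ℝ} {μ₀ : ι → Θ → ℝ}
  {ξ : ℕ → Ω → ∀ k, X k} {ω : Ω}

omit [Fintype ι] in
lemma bayes_eq {μ : ι → Θ → ℝ} {x : ∀ k, X k} {l : ι} (h : 0 < L l θ₀ (x l)) (θ : Θ) :
    bayes L μ x l θ = likelihoodRatio L θ₀ θ x l * μ l θ / predictive L θ₀ μ x l := by
  have : predictive L θ₀ μ x l = (∑ θ', L l θ' (x l) * μ l θ') / L l θ₀ (x l) := by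
    rw [predictive, Finset.sum_div]
    exact Finset.sum_congr rfl fun θ' _ => by rw [likelihoodRatio]; ring
  rw [this, bayes, likelihoodRatio, div_mul_eq_mul_div, div_div_div_cancel_right₀ h.ne']

lemma belief_mem (hA : ∀ l k, 0 ≤ A l k) (hA_stoch : ∀ k, ∑ l, A l k = 1)
    (hμ₀ : ∀ k θ, 0 ≤ μ₀ k θ) (hμ₀_sum : ∀ k, ∑ θ, μ₀ k θ = 1)
    (hL : ∀ i k θ, 0 < L k θ (ξ i ω k)) (i : ℕ) :
    (∀ k θ, 0 ≤ belief A L μ₀ ξ i ω k θ) ∧ ∀ k, ∑ θ, belief A L μ₀ ξ i ω k θ = 1 := by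
  induction i with
  | zero => exact ⟨hμ₀, hμ₀_sum⟩
  | succ i ih =>
    have hnn : ∀ l θ, 0 ≤ L l θ (ξ i ω l) * belief A L μ₀ ξ i ω l θ := fun l θ =>
      mul_nonneg (hL i l θ).le (ih.1 l θ)
    have hb : ∀ l, ∑ θ, bayes L (belief A L μ₀ ξ i ω) (ξ i ω) l θ = 1 := by
      intro l
      simp only [bayes]
      rw [← Finset.sum_div]
      refine div_self (ne_of_gt ?_)
      obtain ⟨θ, -, hθ⟩ := Finset.exists_lt_of_sum_lt (s := Finset.univ)
        (f := fun _ : Θ => (0 : ℝ)) (g := fun θ => belief A L μ₀ ξ i ω l θ) (by simp [ih.2 l])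
      exact Finset.sum_pos' (fun θ _ => hnn l θ) ⟨θ, Finset.mem_univ θ, mul_pos (hL i l θ) hθ⟩
    constructor
    · intro k θ
      exact Finset.sum_nonneg fun l _ => mul_nonneg (hA l k)
        (div_nonneg (hnn l θ) (Finset.sum_nonneg fun θ' _ => hnn l θ'))
    · intro k
      simp only [belief]
      rw [Finset.sum_comm]
      simp only [← Finset.mul_sum, hb, mul_one, hA_stoch]

omit [Fintype ι] in
lemma predictive_pos {μ : ι → Θ → ℝ} {x : ∀ k, X k} {l : ι} (hμ : ∀ θ, 0 ≤ μ l θ)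
    (hsum : ∑ θ, μ l θ = 1) (hr : ∀ θ, 0 < likelihoodRatio L θ₀ θ x l) :
    0 < predictive L θ₀ μ x l := by
  obtain ⟨θ, -, hθ⟩ := Finset.exists_lt_of_sum_lt (s := Finset.univ)
    (f := fun _ : Θ => (0 : ℝ)) (g := fun θ => μ l θ) (by simp [hsum])
  exact Finset.sum_pos' (fun θ _ => mul_nonneg (hr θ).le (hμ θ))
    ⟨θ, Finset.mem_univ θ, mul_pos (hr θ) hθ⟩

lemma predictive_le_totalRatio {μ : ι → Θ → ℝ} {x : ∀ k, X k} (hμ : ∀ k θ, 0 ≤ μ k θ)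
    (hsum : ∀ k, ∑ θ, μ k θ = 1) (hr : ∀ k θ, 0 < likelihoodRatio L θ₀ θ x k) (l : ι) :
    predictive L θ₀ μ x l ≤ totalRatio L θ₀ x := by
  calc predictive L θ₀ μ x l ≤ ∑ θ, likelihoodRatio L θ₀ θ x l := by
        refine Finset.sum_le_sum fun θ _ => mul_le_of_le_one_right (hr l θ).le ?_
        rw [← hsum l]
        exact Finset.single_le_sum (fun θ _ => hμ l θ) (Finset.mem_univ θ)
    _ ≤ _ := Finset.single_le_sum
        (f := fun l => ∑ θ, likelihoodRatio L θ₀ θ x l)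
        (fun l _ => Finset.sum_nonneg fun θ _ => (hr l θ).le) (Finset.mem_univ l)

lemma belief_succ (hL : ∀ i k θ, 0 < L k θ (ξ i ω k)) (i : ℕ) (k : ι) (θ : Θ) :
    belief A L μ₀ ξ (i + 1) ω k θ = ∑ l, A l k * (likelihoodRatio L θ₀ θ (ξ i ω) l *
      belief A L μ₀ ξ i ω l θ / predictive L θ₀ (belief A L μ₀ ξ i ω) (ξ i ω) l) := by
  simp only [belief]
  exact Finset.sum_congr rfl fun l _ => by rw [bayes_eq (hL i l θ₀)]

variable [DecidableEq ι]

/-- The linear recursion that the belief on `θ` follows when it is not normalized. -/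
noncomputable def linearBelief (A : Matrix ι ι ℝ) (L : ∀ k, Θ → X k → ℝ) (θ₀ θ : Θ)
    (μ₀ : ι → Θ → ℝ) (ξ : ℕ → Ω → ∀ k, X k) (i : ℕ) (ω : Ω) : ι → ℝ :=
  listProd (ratioMatrix A L θ₀ θ) (segment ξ 0 i ω).reverse *ᵥ fun l => μ₀ l θ

omit [Fintype Θ] in
lemma linearBelief_succ {θ : Θ} (hr : ∀ i k, 0 < likelihoodRatio L θ₀ θ (ξ i ω) k) (i : ℕ)
    (k : ι) : linearBelief A L θ₀ θ μ₀ ξ (i + 1) ω k =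
      ∑ l, A l k * (likelihoodRatio L θ₀ θ (ξ i ω) l * linearBelief A L θ₀ θ μ₀ ξ i ω l) := by
  rw [linearBelief, segment_add, segment_one, List.reverse_append, List.reverse_singleton,
    List.singleton_append, listProd_cons, ← Matrix.mulVec_mulVec, zero_add]
  refine Finset.sum_congr rfl fun l _ => ?_
  change ratioMatrix A L θ₀ θ (ξ i ω) k l * linearBelief A L θ₀ θ μ₀ ξ i ω l = _
  rw [ratioMatrix_apply, posRatio_eq (hr i), mul_assoc]

omit [Fintype Θ] in
lemma linearBelief_nonneg (hA : ∀ l k, 0 ≤ A l k) (hμ₀ : ∀ k θ, 0 ≤ μ₀ k θ) {θ : Θ}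
    (hr : ∀ i k, 0 < likelihoodRatio L θ₀ θ (ξ i ω) k) (i : ℕ) (k : ι) :
    0 ≤ linearBelief A L θ₀ θ μ₀ ξ i ω k := by
  induction i generalizing k with
  | zero => simpa [linearBelief] using hμ₀ k θ
  | succ i ih =>
    rw [linearBelief_succ hr]
    exact Finset.sum_nonneg fun l _ => mul_nonneg (hA l k) (mul_nonneg (hr i l).le (ih l))

/-- The belief recursion is the linear one with an extra division by the predictive density at each
step; these divisions accumulate to at least `exp (-∑ U)`. -/
lemma le_belief_of_predictive_le (hA : ∀ l k, 0 ≤ A l k) (hμ₀ : ∀ k θ, 0 ≤ μ₀ k θ)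
    (hL : ∀ i k θ, 0 < L k θ (ξ i ω k))
    (hpos : ∀ i l, 0 < predictive L θ₀ (belief A L μ₀ ξ i ω) (ξ i ω) l)
    {U : ℕ → ℝ} (hU : ∀ i l, predictive L θ₀ (belief A L μ₀ ξ i ω) (ξ i ω) l ≤ Real.exp (U i))
    (θ : Θ) (i : ℕ) (k : ι) :
    Real.exp (-∑ j ∈ Finset.range i, U j) * linearBelief A L θ₀ θ μ₀ ξ i ω k ≤
      belief A L μ₀ ξ i ω k θ := by
  have hr : ∀ i k, 0 < likelihoodRatio L θ₀ θ (ξ i ω) k := fun i k =>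
    div_pos (hL i k θ) (hL i k θ₀)
  induction i generalizing k with
  | zero => simp [linearBelief, belief]
  | succ i ih =>
    rw [belief_succ (θ₀ := θ₀) hL, linearBelief_succ hr, Finset.mul_sum]
    refine Finset.sum_le_sum fun l _ => ?_
    rw [mul_left_comm]
    refine mul_le_mul_of_nonneg_left ?_ (hA l k)
    rw [le_div_iff₀ (hpos i l)]
    have hn := linearBelief_nonneg hA hμ₀ hr i l
    calc _ ≤ Real.exp (-∑ j ∈ Finset.range (i + 1), U j) *
          (likelihoodRatio L θ₀ θ (ξ i ω) l * linearBelief A L θ₀ θ μ₀ ξ i ω l) *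
            Real.exp (U i) :=
          mul_le_mul_of_nonneg_left (hU i l)
            (mul_nonneg (Real.exp_pos _).le (mul_nonneg (hr i l).le hn))
      _ = likelihoodRatio L θ₀ θ (ξ i ω) l *
          (Real.exp (-∑ j ∈ Finset.range i, U j) * linearBelief A L θ₀ θ μ₀ ξ i ω l) := by
          rw [Finset.sum_range_succ, neg_add, Real.exp_add, Real.exp_neg (U i)]
          have := (Real.exp_pos (U i)).ne'
          field_simp
      _ ≤ _ := mul_le_mul_of_nonneg_left (ih l) (hr i l).le

lemma belief_le_of_le_predictive (hA : ∀ l k, 0 ≤ A l k) (hμ₀ : ∀ k θ, 0 ≤ μ₀ k θ)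
    (hL : ∀ i k θ, 0 < L k θ (ξ i ω k))
    {U : ℕ → ℝ} (hU : ∀ i l, Real.exp (-U i) ≤ predictive L θ₀ (belief A L μ₀ ξ i ω) (ξ i ω) l)
    (θ : Θ) (i : ℕ) (k : ι) :
    belief A L μ₀ ξ i ω k θ ≤
      Real.exp (∑ j ∈ Finset.range i, U j) * linearBelief A L θ₀ θ μ₀ ξ i ω k := by
  have hr : ∀ i k, 0 < likelihoodRatio L θ₀ θ (ξ i ω) k := fun i k =>
    div_pos (hL i k θ) (hL i k θ₀)
  induction i generalizing k with
  | zero => simp [linearBelief, belief]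
  | succ i ih =>
    rw [belief_succ (θ₀ := θ₀) hL, linearBelief_succ hr, Finset.mul_sum]
    refine Finset.sum_le_sum fun l _ => ?_
    rw [mul_left_comm (Real.exp _)]
    refine mul_le_mul_of_nonneg_left ?_ (hA l k)
    have hn := linearBelief_nonneg hA hμ₀ hr i l
    rw [div_le_iff₀ ((Real.exp_pos _).trans_le (hU i l))]
    calc likelihoodRatio L θ₀ θ (ξ i ω) l * belief A L μ₀ ξ i ω l θ
        ≤ likelihoodRatio L θ₀ θ (ξ i ω) l *
          (Real.exp (∑ j ∈ Finset.range i, U j) * linearBelief A L θ₀ θ μ₀ ξ i ω l) :=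
          mul_le_mul_of_nonneg_left (ih l) (hr i l).le
      _ = Real.exp (∑ j ∈ Finset.range (i + 1), U j) *
          (likelihoodRatio L θ₀ θ (ξ i ω) l * linearBelief A L θ₀ θ μ₀ ξ i ω l) *
            Real.exp (-U i) := by
          rw [Finset.sum_range_succ, Real.exp_add, Real.exp_neg (U i)]
          have := (Real.exp_pos (U i)).ne'
          field_simp
      _ ≤ _ := mul_le_mul_of_nonneg_left (hU i l)
            (mul_nonneg (Real.exp_pos _).le (mul_nonneg (hr i l).le hn))

end Belief

/-! ### Criteria for convergence to zero -/

lemma sq_exp_half_sub_one_le (y : ℝ) : (Real.exp (y / 2) - 1) ^ 2 ≤ Real.exp y - 1 - y := by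
  have h1 := Real.add_one_le_exp (y / 2)
  have h2 : Real.exp y = Real.exp (y / 2) ^ 2 := by
    rw [← Real.exp_nat_mul]; congr 1; push_cast; ring
  -- The right side minus the left is `2 * (exp (y / 2) - 1 - y / 2)`, which is non-negative.
  rw [h2]
  nlinarith

/-- The gap `m - 1 - log m` dominates `(√m - 1) ^ 2`, so `√m` tends to `1`. -/
lemma tendsto_log_zero_of_tendsto {m : ℕ → ℝ} (hm : ∀ i, 0 < m i)
    (h : Tendsto (fun i => m i - 1 - Real.log (m i)) atTop (𝓝 0)) :
    Tendsto (fun i => Real.log (m i)) atTop (𝓝 0) := by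
  have h1 : Tendsto (fun i => (Real.exp (Real.log (m i) / 2) - 1) ^ 2) atTop (𝓝 0) := by
    refine squeeze_zero (fun i => sq_nonneg _) (fun i => ?_) h
    have := sq_exp_half_sub_one_le (Real.log (m i))
    rwa [Real.exp_log (hm i)] at this
  have h2 : Tendsto (fun i => Real.exp (Real.log (m i) / 2) - 1) atTop (𝓝 0) := by
    have := h1.sqrt
    simp only [Real.sqrt_sq_eq_abs, Real.sqrt_zero] at this
    exact (tendsto_zero_iff_abs_tendsto_zero _).2 this
  have h3 : Tendsto (fun i => Real.exp (Real.log (m i) / 2)) atTop (𝓝 1) := by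
    simpa using h2.add_const 1
  have h4 := (h3.log one_ne_zero).const_mul 2
  simpa [mul_div_cancel₀] using h4

/-- Non-negative functions whose integrals have bounded partial sums tend to zero. -/
lemma ae_tendsto_zero_of_sum_integral_le {Ω : Type*} [MeasurableSpace Ω] {P : Measure Ω}
    {f : ℕ → Ω → ℝ} (hf : ∀ i, Integrable (f i) P) (hf0 : ∀ i, 0 ≤ᵐ[P] f i) {K : ℝ}
    (hK : ∀ n, ∑ i ∈ Finset.range n, ∫ ω, f i ω ∂P ≤ K) :
    ∀ᵐ ω ∂P, Tendsto (fun i => f i ω) atTop (𝓝 0) := by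
  -- The sum of the series has finite integral, hence is finite almost everywhere, and the terms of
  -- a convergent series vanish in the limit.
  have hlint : ∫⁻ ω, ∑' i, ENNReal.ofReal (f i ω) ∂P ≤ ENNReal.ofReal K := by
    rw [lintegral_tsum fun i => (hf i).aemeasurable.ennreal_ofReal]
    refine ENNReal.tsum_le_of_sum_range_le fun n => ?_
    simp only [← fun i => ofReal_integral_eq_lintegral_ofReal (hf i) (hf0 i)]
    rw [← ENNReal.ofReal_sum_of_nonneg fun i _ => integral_nonneg_of_ae (hf0 i)]
    exact ENNReal.ofReal_le_ofReal (hK n)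
  have hfin : ∀ᵐ ω ∂P, ∑' i, ENNReal.ofReal (f i ω) < ⊤ := by
    refine ae_lt_top' (AEMeasurable.tsum fun i =>
      (hf i).aemeasurable.ennreal_ofReal) (hlint.trans_lt ENNReal.ofReal_lt_top).ne
  filter_upwards [hfin, ae_all_iff.2 hf0] with ω hω h0
  have h1 := ENNReal.tendsto_atTop_zero_of_tsum_ne_top hω.ne
  have h2 := (ENNReal.tendsto_toReal ENNReal.zero_ne_top).comp h1
  refine h2.congr fun i => ?_
  simp [ENNReal.toReal_ofReal (h0 i)]

/-! ### Beliefs depend on past signals only -/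

section Measurable

variable {ι Θ Ω : Type*} [Fintype ι] [Fintype Θ] {X : ι → Type*} [∀ k, MeasurableSpace (X k)]
  {L : ∀ k, Θ → X k → ℝ} {A : Matrix ι ι ℝ} {μ₀ : ι → Θ → ℝ} {ξ : ℕ → Ω → ∀ k, X k}

/-- Only the signals before time index `i` are assumed measurable, so that the lemma also applies to
the σ-algebra that they generate. -/
lemma measurable_belief [MeasurableSpace Ω] (hL : ∀ k θ, Measurable (L k θ)) {i : ℕ}
    (hξ : ∀ j < i, Measurable (ξ j)) (k : ι) (θ : Θ) :
    Measurable fun ω => belief A L μ₀ ξ i ω k θ := by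
  induction i generalizing k θ with
  | zero => exact measurable_const
  | succ i ih =>
    have hm : ∀ l θ', Measurable fun ω => L l θ' (ξ i ω l) := fun l θ' =>
      (hL l θ').comp ((measurable_pi_apply l).comp (hξ i i.lt_succ_self))
    have hb := fun l θ' => ih (fun j hj => hξ j (hj.trans i.lt_succ_self)) l θ'
    simp only [belief, bayes]
    exact Finset.measurable_sum _ fun l _ => (((hm l θ).mul (hb l θ)).div
      (Finset.measurable_sum _ fun θ' _ => (hm l θ').mul (hb l θ'))).const_mul _

lemma indepFun_belief [MeasurableSpace Ω] {P : Measure Ω} (hL : ∀ k θ, Measurable (L k θ))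
    (hξ : IsIID P ξ) (i : ℕ) {f : (∀ k, X k) → ℝ} (hf : Measurable f) (k : ι) (θ : Θ) :
    IndepFun (fun ω => f (ξ i ω)) (fun ω => belief A L μ₀ ξ i ω k θ) P := by
  have h := indep_iSup_of_disjoint (fun j => (hξ.measurable j).comap_le) hξ.indep
    (S := {i}) (T := Set.Iio i) (by simp)
  refine indep_of_indep_of_le_left (indep_of_indep_of_le_right h ?_) ?_
  · refine Measurable.comap_le ?_
    refine @measurable_belief ι Θ Ω _ _ X _ L A μ₀ ξ (_) hL i (fun j hj => ?_) k θ
    refine Measurable.mono (comap_measurable (ξ j)) ?_ le_rfl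
    exact le_iSup₂_of_le j hj le_rfl
  · refine Measurable.comap_le ?_
    refine hf.comp (Measurable.mono (comap_measurable (ξ i)) ?_ le_rfl)
    exact le_iSup₂_of_le i rfl le_rfl

end Measurable

/-! ### Convergence of the predictive densities -/

section PredictiveLimit

variable {ι Θ Ω : Type*} [Fintype ι] [DecidableEq ι] [Nonempty ι] [Fintype Θ] {X : ι → Type*}
  [∀ k, MeasurableSpace (X k)] [MeasurableSpace Ω] {P : Measure Ω} [IsProbabilityMeasure P]
  {L : ∀ k, Θ → X k → ℝ} {θ₀ : Θ} {ξ : ℕ → Ω → ∀ k, X k} {D : ι → Θ → ℝ} {A : Matrix ι ι ℝ}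
  {μ₀ : ι → Θ → ℝ}

/-- The predictive densities of all agents converge to the density under the true hypothesis. -/
theorem IsSignal.ae_tendsto_log_predictive (h : IsSignal P ξ L θ₀ D)
    (hA : A.IsPrimitive) (hA_stoch : ∀ k, ∑ l, A l k = 1)
    (hμ₀ : ∀ k θ, 0 ≤ μ₀ k θ) (hμ₀_sum : ∀ k, ∑ θ, μ₀ k θ = 1) (hμ₀_pos : ∃ k, 0 < μ₀ k θ₀) :
    ∀ᵐ ω ∂P, ∀ l, Tendsto
      (fun i => Real.log (predictive L θ₀ (belief A L μ₀ ξ i ω) (ξ i ω) l)) atTop (𝓝 0) := by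
  set b : ℕ → Ω → ι → ℝ := fun i ω k => belief A L μ₀ ξ i ω k θ₀ with hb
  set m : ℕ → Ω → ι → ℝ := fun i ω l => predictive L θ₀ (belief A L μ₀ ξ i ω) (ξ i ω) l with hm
  set Z : ℕ → Ω → ℝ := fun i ω => totalRatio L θ₀ (ξ i ω) with hZ
  obtain ⟨p, hp0, hp⟩ := exists_forall_pow_pos (isPrimitive_transpose hA)
  obtain ⟨π, hπ, hAπ⟩ := exists_pos_fixed_vector hA hA_stoch
  -- Unnormalized belief on `θ₀`; it is deterministic because the ratios of `θ₀` to itself are `1`.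
  -- Some agents may start with no mass on `θ₀`, so positivity is claimed only from time `p` on.
  set v : ℕ → ι → ℝ := fun i => (Aᵀ ^ i) *ᵥ fun l => μ₀ l θ₀ with hv
  have hv_pos : ∀ i, p ≤ i → ∀ k, 0 < v i k := by
    intro i hi k
    obtain ⟨k₀, hk₀⟩ := hμ₀_pos
    exact Finset.sum_pos' (fun l _ => mul_nonneg (hp i hi k l).le (hμ₀ l θ₀))
      ⟨k₀, Finset.mem_univ _, mul_pos (hp i hi k k₀) hk₀⟩
  have hmem : ∀ᵐ ω ∂P, ∀ i, (∀ k θ, 0 ≤ belief A L μ₀ ξ i ω k θ) ∧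
      ∀ k, ∑ θ, belief A L μ₀ ξ i ω k θ = 1 := by
    filter_upwards [h.ae_pos] with ω hω i
    exact belief_mem hA.nonneg hA_stoch hμ₀ hμ₀_sum hω i
  have hm_pos : ∀ᵐ ω ∂P, ∀ i l, 0 < m i ω l := by
    filter_upwards [hmem, h.ae_ratio_pos] with ω h1 h2 i l
    exact predictive_pos ((h1 i).1 l) ((h1 i).2 l) (h2 i l)
  have hm_le : ∀ᵐ ω ∂P, ∀ i l, m i ω l ≤ Z i ω := by
    filter_upwards [hmem, h.ae_ratio_pos] with ω h1 h2 i l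
    exact predictive_le_totalRatio (h1 i).1 (h1 i).2 (h2 i) l
  have hb_le : ∀ᵐ ω ∂P, ∀ i k, b i ω k ≤ 1 := by
    filter_upwards [hmem] with ω h1 i k
    rw [← (h1 i).2 k]
    exact Finset.single_le_sum (fun θ _ => (h1 i).1 k θ) (Finset.mem_univ θ₀)
  have hratio_self : ∀ᵐ ω ∂P, ∀ i l, likelihoodRatio L θ₀ θ₀ (ξ i ω) l = 1 := by
    filter_upwards [h.ae_pos] with ω h1 i l
    exact div_self (h1 i l θ₀).ne'
  -- A crude bound with integrable exponent, from `m ≤ Z ≤ exp Z`; its purpose is the integrability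
  -- of `log b`.
  have hb_ge : ∀ᵐ ω ∂P, ∀ i k, Real.exp (-∑ j ∈ Finset.range i, Z j ω) * v i k ≤ b i ω k := by
    filter_upwards [h.ae_pos, hm_pos, hm_le, h.ae_ratio_pos, hratio_self] with ω h1 h2 h3 h4 h5 i k
    have hlin : ∀ i, linearBelief A L θ₀ θ₀ μ₀ ξ i ω = v i := by
      intro i
      induction i with
      | zero => simp [linearBelief, hv]
      | succ i ih =>
        funext k
        rw [linearBelief_succ fun i k => h4 i k θ₀, ih]
        simp only [h5, one_mul, hv, pow_succ']
        rw [← Matrix.mulVec_mulVec]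
        rfl
    have := le_belief_of_predictive_le hA.nonneg hμ₀ h1 h2 (U := fun i => Z i ω)
      (fun i l => (h3 i l).trans (by linarith [Real.add_one_le_exp (Z i ω)])) θ₀ i k
    rwa [hlin] at this
  have hb_pos : ∀ᵐ ω ∂P, ∀ i, p ≤ i → ∀ k, 0 < b i ω k := by
    filter_upwards [hb_ge] with ω h1 i hi k
    exact (mul_pos (Real.exp_pos _) (hv_pos i hi k)).trans_le (h1 i k)
  have hm_ge : ∀ᵐ ω ∂P, ∀ i l, b i ω l ≤ m i ω l := by
    filter_upwards [hmem, h.ae_ratio_pos, hratio_self] with ω h1 h2 h3 i l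
    have := Finset.single_le_sum (f := fun θ =>
      likelihoodRatio L θ₀ θ (ξ i ω) l * belief A L μ₀ ξ i ω l θ)
      (fun θ _ => mul_nonneg (h2 i l θ).le ((h1 i).1 l θ)) (Finset.mem_univ θ₀)
    simp only [h3, one_mul] at this
    exact this
  have hb_meas : ∀ i k θ, Measurable fun ω => belief A L μ₀ ξ i ω k θ := fun i k θ =>
    measurable_belief h.measurable (fun j _ => h.iid.measurable j) k θ
  have hr_meas : ∀ i l θ, Measurable fun ω => likelihoodRatio L θ₀ θ (ξ i ω) l := fun i l θ =>
    (measurable_likelihoodRatio h.measurable θ₀ θ l).comp (h.iid.measurable i)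
  have hm_meas : ∀ i l, Measurable fun ω => m i ω l := fun i l =>
    Finset.measurable_sum _ fun θ _ => (hr_meas i l θ).mul (hb_meas i l θ)
  have hZ_int : ∀ i, Integrable (Z i) P := fun i =>
    integrable_finsetSum _ fun l _ => integrable_finsetSum _ fun θ _ => h.integrable i l θ
  have hlogb_int : ∀ i, p ≤ i → ∀ k, Integrable (fun ω => Real.log (b i ω k)) P := by
    intro i hi k
    refine integrable_of_le_of_le (g₁ := fun ω => -∑ j ∈ Finset.range i, Z j ω + Real.log (v i k))
      (g₂ := fun _ => (0 : ℝ)) (hb_meas i k θ₀).log.aestronglyMeasurable ?_ ?_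
      ((integrable_finsetSum _ fun j _ => hZ_int j).neg.add (integrable_const _))
      (integrable_const _)
    · filter_upwards [hb_ge] with ω h1
      have := Real.log_le_log (mul_pos (Real.exp_pos _) (hv_pos i hi k)) (h1 i k)
      rwa [Real.log_mul (Real.exp_pos _).ne' (hv_pos i hi k).ne', Real.log_exp] at this
    · filter_upwards [hb_le, hb_pos] with ω h1 h2
      exact Real.log_nonpos (h2 i hi k).le (h1 i k)
  have hlogm_int : ∀ i, p ≤ i → ∀ l, Integrable (fun ω => Real.log (m i ω l)) P := by
    intro i hi l
    refine integrable_of_le_of_le (hm_meas i l).log.aestronglyMeasurable ?_ ?_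
      (hlogb_int i hi l) (hZ_int i)
    · filter_upwards [hm_ge, hb_pos] with ω h1 h2
      exact Real.log_le_log (h2 i hi l) (h1 i l)
    · filter_upwards [hm_le, hm_pos] with ω h1 h2
      linarith [Real.log_le_sub_one_of_pos (h2 i l), h1 i l]
  have hm_int : ∀ i l, Integrable (fun ω => m i ω l) P := by
    intro i l
    refine integrable_of_le_of_le (g₁ := fun _ => (0 : ℝ)) (hm_meas i l).aestronglyMeasurable ?_ ?_
      (integrable_const _) (hZ_int i)
    · filter_upwards [hm_pos] with ω h1 using (h1 i l).le
    · filter_upwards [hm_le] with ω h1 using h1 i l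
  have hbθ_int : ∀ i l θ, Integrable (fun ω => belief A L μ₀ ξ i ω l θ) P := by
    intro i l θ
    refine integrable_of_le_of_le (g₁ := fun _ => (0 : ℝ)) (g₂ := fun _ => (1 : ℝ))
      (hb_meas i l θ).aestronglyMeasurable ?_ ?_ (integrable_const _) (integrable_const _)
    · filter_upwards [hmem] with ω h1 using (h1 i).1 l θ
    · filter_upwards [hmem] with ω h1
      rw [← (h1 i).2 l]
      exact Finset.single_le_sum (fun θ _ => (h1 i).1 l θ) (Finset.mem_univ θ)
  -- The next signal is independent of the current belief, each ratio has mean at most `1`, and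
  -- beliefs sum to `1`.
  have hm_le_one : ∀ i l, ∫ ω, m i ω l ∂P ≤ 1 := by
    intro i l
    have hind := fun θ => indepFun_belief (A := A) (μ₀ := μ₀) h.measurable h.iid i
      (measurable_likelihoodRatio h.measurable θ₀ θ l) l θ
    have hprod : ∀ θ, Integrable (fun ω =>
        likelihoodRatio L θ₀ θ (ξ i ω) l * belief A L μ₀ ξ i ω l θ) P := fun θ =>
      (hind θ).integrable_mul (h.integrable i l θ) (hbθ_int i l θ)
    calc ∫ ω, m i ω l ∂P
        = ∑ θ, ∫ ω, likelihoodRatio L θ₀ θ (ξ i ω) l * belief A L μ₀ ξ i ω l θ ∂P :=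
          integral_finsetSum _ fun θ _ => hprod θ
      _ = ∑ θ, (∫ ω, likelihoodRatio L θ₀ θ (ξ i ω) l ∂P) * ∫ ω, belief A L μ₀ ξ i ω l θ ∂P :=
          Finset.sum_congr rfl fun θ _ => (hind θ).integral_fun_mul_eq_mul_integral
            (hr_meas i l θ).aestronglyMeasurable (hb_meas i l θ).aestronglyMeasurable
      _ ≤ ∑ θ, ∫ ω, belief A L μ₀ ξ i ω l θ ∂P :=
          Finset.sum_le_sum fun θ _ => mul_le_of_le_one_left
            (integral_nonneg_of_ae (by filter_upwards [hmem] with ω h1 using (h1 i).1 l θ))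
            (h.integral_le i l θ)
      _ = ∫ ω, ∑ θ, belief A L μ₀ ξ i ω l θ ∂P :=
          (integral_finsetSum _ fun θ _ => hbθ_int i l θ).symm
      _ = 1 := by
          rw [integral_congr_ae (g := fun _ => (1 : ℝ))
            (by filter_upwards [hmem] with ω h1 using (h1 i).2 l)]
          simp
  -- Concavity of `log` handles the averaging over neighbors, and the weights `π` are reproduced
  -- because `A π = π`.
  have hjensen : ∀ᵐ ω ∂P, ∀ i, p ≤ i →
      ∑ l, π l * (Real.log (b i ω l) - Real.log (m i ω l)) ≤
        ∑ k, π k * Real.log (b (i + 1) ω k) := by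
    filter_upwards [h.ae_pos, hm_pos, hb_pos, hratio_self] with ω h1 h2 h3 h4 i hi
    have hstep : ∀ k, ∑ l, A l k * (Real.log (b i ω l) - Real.log (m i ω l)) ≤
        Real.log (b (i + 1) ω k) := by
      intro k
      have hq : ∀ l, 0 < b i ω l / m i ω l := fun l => div_pos (h3 i hi l) (h2 i l)
      have hconc := strictConcaveOn_log_Ioi.concaveOn.le_map_sum (t := Finset.univ)
        (w := fun l => A l k) (p := fun l => b i ω l / m i ω l) (fun l _ => hA.nonneg l k)
        (hA_stoch k) (fun l _ => hq l)
      simp only [smul_eq_mul] at hconc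
      have hsucc : b (i + 1) ω k = ∑ l, A l k * (b i ω l / m i ω l) := by
        simp only [hb, hm]
        rw [belief_succ (θ₀ := θ₀) h1]
        simp only [h4, one_mul]
      rw [hsucc]
      refine (le_of_eq (Finset.sum_congr rfl fun l _ => ?_)).trans hconc
      rw [Real.log_div (h3 i hi l).ne' (h2 i l).ne']
    calc ∑ l, π l * (Real.log (b i ω l) - Real.log (m i ω l))
        = ∑ l, (∑ k, A l k * π k) * (Real.log (b i ω l) - Real.log (m i ω l)) := by
          simp only [hAπ]
      _ = ∑ k, π k * ∑ l, A l k * (Real.log (b i ω l) - Real.log (m i ω l)) := by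
          simp only [Finset.sum_mul, Finset.mul_sum]
          rw [Finset.sum_comm]
          exact Finset.sum_congr rfl fun k _ => Finset.sum_congr rfl fun l _ => by ring
      _ ≤ _ := Finset.sum_le_sum fun k _ => mul_le_mul_of_nonneg_left (hstep k) (hπ k).le
  set Φ : ℕ → Ω → ℝ := fun i ω => ∑ l, π l * (m i ω l - 1 - Real.log (m i ω l)) with hΦ
  set V : ℕ → ℝ := fun i => ∑ k, π k * ∫ ω, Real.log (b i ω k) ∂P with hV
  have hφ_int : ∀ i, p ≤ i → ∀ l,
      Integrable (fun ω => m i ω l - 1 - Real.log (m i ω l)) P := fun i hi l =>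
    ((hm_int i l).sub (integrable_const 1)).sub (hlogm_int i hi l)
  have hΦ_int : ∀ i, p ≤ i → Integrable (Φ i) P := fun i hi =>
    integrable_finsetSum _ fun l _ => (hφ_int i hi l).const_mul _
  have hφ_nonneg : ∀ᵐ ω ∂P, ∀ i l, 0 ≤ m i ω l - 1 - Real.log (m i ω l) := by
    filter_upwards [hm_pos] with ω h1 i l
    linarith [Real.log_le_sub_one_of_pos (h1 i l)]
  have hΦ_nonneg : ∀ i, 0 ≤ᵐ[P] Φ i := by
    intro i
    filter_upwards [hφ_nonneg] with ω h1
    exact Finset.sum_nonneg fun l _ => mul_nonneg (hπ l).le (h1 i l)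
  -- Jensen bounds the increment of `V` below by `-∑ π_l 𝔼 log m_l`; adding `𝔼 m_l - 1 ≤ 0` turns
  -- this into the mean of the non-negative `Φ`.
  have hΦ_le : ∀ i, p ≤ i → ∫ ω, Φ i ω ∂P ≤ V (i + 1) - V i := by
    intro i hi
    have e1 : ∫ ω, Φ i ω ∂P ≤ ∑ l, π l * -∫ ω, Real.log (m i ω l) ∂P := by
      rw [hΦ, integral_finsetSum _ fun l _ => (hφ_int i hi l).const_mul _]
      refine Finset.sum_le_sum fun l _ => ?_
      rw [integral_const_mul]
      refine mul_le_mul_of_nonneg_left ?_ (hπ l).le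
      have i1 : Integrable (fun ω => m i ω l - 1) P := (hm_int i l).sub (integrable_const 1)
      rw [integral_sub i1 (hlogm_int i hi l), integral_sub (hm_int i l) (integrable_const 1)]
      simp only [integral_const, probReal_univ, smul_eq_mul, mul_one]
      linarith [hm_le_one i l]
    have i2 : ∀ l, Integrable (fun ω => Real.log (b i ω l) - Real.log (m i ω l)) P := fun l =>
      (hlogb_int i hi l).sub (hlogm_int i hi l)
    have e2 := integral_mono_ae (integrable_finsetSum Finset.univ fun l _ => (i2 l).const_mul (π l))
      (integrable_finsetSum Finset.univ fun k _ =>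
        (hlogb_int (i + 1) (hi.trans i.le_succ) k).const_mul (π k))
      (by filter_upwards [hjensen] with ω h1 using h1 i hi)
    rw [integral_finsetSum _ fun l _ => (i2 l).const_mul (π l),
      integral_finsetSum _ fun k _ =>
        (hlogb_int (i + 1) (hi.trans i.le_succ) k).const_mul (π k)] at e2
    simp only [integral_const_mul] at e2
    have e3 : ∑ l, π l * ∫ ω, (Real.log (b i ω l) - Real.log (m i ω l)) ∂P =
        V i + ∑ l, π l * -∫ ω, Real.log (m i ω l) ∂P := by
      rw [hV, ← Finset.sum_add_distrib]
      refine Finset.sum_congr rfl fun l _ => ?_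
      rw [integral_sub (hlogb_int i hi l) (hlogm_int i hi l)]
      ring
    rw [e3] at e2
    linarith
  have hV_nonpos : ∀ i, p ≤ i → V i ≤ 0 := by
    intro i hi
    refine Finset.sum_nonpos fun k _ => mul_nonpos_of_nonneg_of_nonpos (hπ k).le ?_
    refine integral_nonpos_of_ae ?_
    filter_upwards [hb_le, hb_pos] with ω h1 h2
    exact Real.log_nonpos (h2 i hi k).le (h1 i k)
  -- The increments telescope, and `V` never exceeds `0`.
  have hsum : ∀ n, ∑ i ∈ Finset.range n, ∫ ω, Φ (i + p) ω ∂P ≤ -V p := by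
    intro n
    have : ∑ i ∈ Finset.range n, ∫ ω, Φ (i + p) ω ∂P ≤
        ∑ i ∈ Finset.range n, (V (i + 1 + p) - V (i + p)) :=
      Finset.sum_le_sum fun i _ => by
        have := hΦ_le (i + p) (Nat.le_add_left p i)
        rwa [add_right_comm] at this
    rw [Finset.sum_range_sub (fun i => V (i + p)), zero_add] at this
    linarith [hV_nonpos (n + p) (Nat.le_add_left p n)]
  have hlim := ae_tendsto_zero_of_sum_integral_le
    (fun i => hΦ_int (i + p) (Nat.le_add_left p i)) (fun i => hΦ_nonneg (i + p)) hsum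
  filter_upwards [hlim, hm_pos, hφ_nonneg] with ω h1 h2 h3 l
  refine tendsto_log_zero_of_tendsto (fun i => h2 i l) ?_
  have h4 : Tendsto (fun i => (π l)⁻¹ * Φ i ω) atTop (𝓝 0) := by
    simpa using ((tendsto_add_atTop_iff_nat (f := fun i => Φ i ω) p).1 h1).const_mul (π l)⁻¹
  refine squeeze_zero (fun i => h3 i l) (fun i => ?_) h4
  rw [← div_eq_inv_mul, le_div_iff₀ (hπ l), mul_comm]
  exact Finset.single_le_sum (f := fun l => π l * (m i ω l - 1 - Real.log (m i ω l)))
    (fun l _ => mul_nonneg (hπ l).le (h3 i l)) (Finset.mem_univ l)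

end PredictiveLimit

/-! ### Decay rate of the beliefs and the self-loop bound -/

section DecayRate

variable {ι Θ Ω : Type*} [Fintype ι] [DecidableEq ι] {X : ι → Type*}
  [∀ k, MeasurableSpace (X k)] [MeasurableSpace Ω] {P : Measure Ω}
  {L : ∀ k, Θ → X k → ℝ} {θ₀ θ : Θ} {ξ : ℕ → Ω → ∀ k, X k} {D : ι → Θ → ℝ} {A : Matrix ι ι ℝ}
  {μ₀ : ι → Θ → ℝ} {γ : ℝ}

omit [DecidableEq ι] [Fintype ι] in
lemma IsGrowthRate.congr {Y Y' : ℕ → Ω → Matrix ι ι ℝ} (h : IsGrowthRate P Y γ)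
    (hY : ∀ᵐ ω ∂P, ∀ n, Y n ω = Y' n ω) : IsGrowthRate P Y' γ where
  eventually_pos := h.eventually_pos.mono fun n hn => by
    filter_upwards [hn, hY] with ω h1 h2
    rwa [← h2]
  eventually_integrable := h.eventually_integrable.mono fun n hn l k =>
    (integrable_congr (by filter_upwards [hY] with ω h2; rw [h2])).1 (hn l k)
  tendsto_ae l k := by
    filter_upwards [h.tendsto_ae l k, hY] with ω h1 h2
    simpa only [h2] using h1
  tendsto_integral l k := by
    refine (h.tendsto_integral l k).congr fun n => ?_
    rw [integral_congr_ae (g := fun ω => Real.log (Y' n ω l k))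
      (by filter_upwards [hY] with ω h2; rw [h2])]

lemma IsSignal.ae_prodY_eq (h : IsSignal P ξ L θ₀ D) (θ : Θ) :
    ∀ᵐ ω ∂P, ∀ n, prodY A L θ₀ θ ξ n ω =
      listProd (ratioMatrix A L θ₀ θ) (segment ξ 0 n ω) := by
  filter_upwards [h.ae_ratio_pos] with ω hω n
  induction n with
  | zero => simp [prodY]
  | succ n ih =>
    rw [prodY, ih, segment_add, listProd_append, segment_one, listProd_cons, listProd_nil, mul_one,
      ratioMatrix, zero_add, posRatio_eq fun k => hω n k θ]

omit [∀ k, MeasurableSpace (X k)] in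
-- The diagonal entry is a sum of non-negative terms over closed paths at `k`; only the path that
-- never leaves `k` is kept.
lemma exp_sum_log_le_listProd_diag (hA : ∀ l k, 0 ≤ A l k) {k : ι} (hk : 0 < A k k)
    (s : List (∀ k, X k)) :
    Real.exp (s.map fun x => Real.log (A k k) + Real.log (posRatio L θ₀ θ x k)).sum ≤
      listProd (ratioMatrix A L θ₀ θ) s k k := by
  have hM : ∀ x l k, 0 ≤ ratioMatrix A L θ₀ θ x l k := fun x l k => by
    rw [ratioMatrix_apply]
    exact mul_nonneg (hA k l) (posRatio_pos x k).le
  have hnn : ∀ (s : List (∀ k, X k)) l k, 0 ≤ listProd (ratioMatrix A L θ₀ θ) s l k := by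
    intro s
    induction s with
    | nil => intro l k; rw [listProd_nil, Matrix.one_apply]; split_ifs <;> norm_num
    | cons x s ih =>
      intro l k
      rw [listProd_cons, Matrix.mul_apply]
      exact Finset.sum_nonneg fun q _ => mul_nonneg (hM x l q) (ih q k)
  induction s with
  | nil => simp
  | cons x s ih =>
    rw [List.map_cons, List.sum_cons, Real.exp_add, Real.exp_add, Real.exp_log hk,
      Real.exp_log (posRatio_pos x k), ← ratioMatrix_apply, listProd_cons, Matrix.mul_apply]
    exact (mul_le_mul_of_nonneg_left ih (hM x k k)).trans (Finset.single_le_sum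
      (f := fun q => ratioMatrix A L θ₀ θ x k q * listProd (ratioMatrix A L θ₀ θ) s q k)
      (fun q _ => mul_nonneg (hM x k q) (hnn s q k)) (Finset.mem_univ k))

/-- The growth rate is bounded below by that of the product along the self-loop at agent `k`. -/
lemma IsSignal.log_diag_sub_le [IsProbabilityMeasure P] (h : IsSignal P ξ L θ₀ D)
    (hA : ∀ l k, 0 ≤ A l k) {k : ι} (hk : 0 < A k k)
    (hγ : IsGrowthRate P (fun n ω => listProd (ratioMatrix A L θ₀ θ) (segment ξ 0 n ω)) γ) :
    Real.log (A k k) - D k θ ≤ γ := by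
  set f : (∀ k, X k) → ℝ := fun x => Real.log (A k k) + Real.log (posRatio L θ₀ θ x k)
  have hf : Measurable f := (measurable_posRatio h.measurable θ₀ θ k).log.const_add _
  have hfi : Integrable (fun ω => f (ξ 0 ω)) P :=
    (integrable_const _).add (h.integrable_log_posRatio 0 k θ)
  have hfe : ∫ ω, f (ξ 0 ω) ∂P = Real.log (A k k) - D k θ := by
    simp only [f]
    rw [integral_add (integrable_const _) (h.integrable_log_posRatio 0 k θ), sub_eq_add_neg,
      ← h.integral_log 0 k θ]
    congr 1
    · simp
    · refine integral_congr_ae ?_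
      filter_upwards [h.ae_ratio_pos] with ω hω
      rw [posRatio_eq fun k => hω 0 k θ]
  refine ge_of_tendsto (hγ.tendsto_integral k k) ?_
  filter_upwards [hγ.eventually_integrable, eventually_gt_atTop 0] with n hn hn0
  have hn' : (0 : ℝ) < n := by exact_mod_cast hn0
  rw [one_div_mul_eq_div, le_div_iff₀ hn', mul_comm, ← hfe,
    ← h.iid.integral_sum_segment hf hfi 0 n]
  refine integral_mono (h.iid.integrable_sum_segment hf hfi 0 n) (hn k k) fun ω => ?_
  have := exp_sum_log_le_listProd_diag (L := L) (θ₀ := θ₀) (θ := θ) hA hk (segment ξ 0 n ω)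
  exact (Real.le_log_iff_exp_le ((Real.exp_pos _).trans_le this)).2 this

omit [DecidableEq ι] in
-- One entry with positive weight bounds the logarithm below; above, finitely many entries share a
-- common exponential bound.
lemma tendsto_log_mulVec [Nonempty ι] {Y : ℕ → Matrix ι ι ℝ} {k : ι}
    (hpos : ∀ᶠ n in atTop, ∀ l, 0 < Y n k l)
    (hY : ∀ l, Tendsto (fun n : ℕ => (1 / (n : ℝ)) * Real.log (Y n k l)) atTop (𝓝 γ))
    {v : ι → ℝ} (hv : ∀ l, 0 ≤ v l) (hv0 : ∃ l, 0 < v l) :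
    Tendsto (fun n : ℕ => (1 / (n : ℝ)) * Real.log ((Y n *ᵥ v) k)) atTop (𝓝 γ) := by
  obtain ⟨l₀, hl₀⟩ := hv0
  have hS : 0 < ∑ l, v l := Finset.sum_pos' (fun l _ => hv l) ⟨l₀, Finset.mem_univ _, hl₀⟩
  have hmul : ∀ n, (Y n *ᵥ v) k = ∑ l, Y n k l * v l := fun n => rfl
  have hlog : ∀ᶠ n : ℕ in atTop, Real.log (v l₀) + Real.log (Y n k l₀) ≤
      Real.log ((Y n *ᵥ v) k) := by
    filter_upwards [hpos] with n hn
    rw [← Real.log_mul hl₀.ne' (hn l₀).ne', hmul, mul_comm]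
    exact Real.log_le_log (mul_pos (hn l₀) hl₀) (Finset.single_le_sum
      (f := fun l => Y n k l * v l) (fun l _ => mul_nonneg (hn l).le (hv l)) (Finset.mem_univ l₀))
  have hposv : ∀ᶠ n : ℕ in atTop, 0 < (Y n *ᵥ v) k := by
    filter_upwards [hpos] with n hn
    rw [hmul]
    exact Finset.sum_pos' (fun l _ => mul_nonneg (hn l).le (hv l))
      ⟨l₀, Finset.mem_univ _, mul_pos (hn l₀) hl₀⟩
  have hlin : ∀ ε : ℝ, 0 < ε → ∀ C : ℝ, ∀ᶠ n : ℕ in atTop, C ≤ ε * n := fun ε hε C =>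
    (tendsto_natCast_atTop_atTop.const_mul_atTop hε).eventually_ge_atTop C
  refine tendsto_one_div_mul_of_eventually (fun ε hε => ?_) (fun ε hε => ?_)
  · filter_upwards [hlog, (hY l₀).eventually_const_lt (u := γ - ε / 2) (by linarith),
      hlin (ε / 2) (by positivity) (-Real.log (v l₀)), eventually_gt_atTop 0] with n h1 h2 h3 h4
    have h4' : (0 : ℝ) < n := by exact_mod_cast h4
    rw [one_div_mul_eq_div, lt_div_iff₀ h4'] at h2
    linarith
  · have hall : ∀ᶠ n : ℕ in atTop, ∀ l, (1 / (n : ℝ)) * Real.log (Y n k l) < γ + ε / 2 :=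
      eventually_all.2 fun l => (hY l).eventually_lt_const (by linarith)
    filter_upwards [hposv, hall, hpos, hlin (ε / 2) (by positivity) (Real.log (∑ l, v l)),
      eventually_gt_atTop 0] with n h0 h1 h2 h3 h4
    have h4' : (0 : ℝ) < n := by exact_mod_cast h4
    have h5 : (Y n *ᵥ v) k ≤ Real.exp ((γ + ε / 2) * n) * ∑ l, v l := by
      rw [hmul, Finset.mul_sum]
      refine Finset.sum_le_sum fun l _ => mul_le_mul_of_nonneg_right ?_ (hv l)
      rw [← Real.log_le_iff_le_exp (h2 l)]
      have := h1 l
      rw [one_div_mul_eq_div, div_lt_iff₀ h4'] at this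
      exact this.le
    have h6 := Real.log_le_log h0 h5
    rw [Real.log_mul (Real.exp_pos _).ne' hS.ne', Real.log_exp] at h6
    linarith

/-- The beliefs decay at the rate at which the reversed random products grow. -/
theorem IsSignal.isDecayRate [Fintype Θ] [Nonempty ι] [IsProbabilityMeasure P]
    (h : IsSignal P ξ L θ₀ D)
    (hA : A.IsPrimitive) (hA_stoch : ∀ k, ∑ l, A l k = 1)
    (hμ₀ : ∀ k θ, 0 ≤ μ₀ k θ) (hμ₀_sum : ∀ k, ∑ θ, μ₀ k θ = 1) (hμ₀_pos₀ : ∃ k, 0 < μ₀ k θ₀)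
    (hμ₀_pos : ∃ k, 0 < μ₀ k θ)
    (hγ : IsGrowthRate P
      (fun n ω => listProd (ratioMatrix A L θ₀ θ) (segment ξ 0 n ω).reverse) γ) :
    IsDecayRate P (belief A L μ₀ ξ) θ (-γ) := by
  -- A single sequence that bounds `|log m_l|` for all agents, so it serves in both the upper and
  -- the lower comparison with the linear recursion.
  set U : ℕ → Ω → ℝ := fun i ω =>
    ∑ l, |Real.log (predictive L θ₀ (belief A L μ₀ ξ i ω) (ξ i ω) l)|
  have hbounds : ∀ᵐ ω ∂P, ∀ i k,
      Real.exp (-∑ j ∈ Finset.range i, U j ω) * linearBelief A L θ₀ θ μ₀ ξ i ω k ≤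
        belief A L μ₀ ξ i ω k θ ∧
      belief A L μ₀ ξ i ω k θ ≤
        Real.exp (∑ j ∈ Finset.range i, U j ω) * linearBelief A L θ₀ θ μ₀ ξ i ω k := by
    filter_upwards [h.ae_pos, h.ae_ratio_pos] with ω h1 h2 i k
    have hpos : ∀ i l, 0 < predictive L θ₀ (belief A L μ₀ ξ i ω) (ξ i ω) l := fun i l =>
      have hmem := belief_mem hA.nonneg hA_stoch hμ₀ hμ₀_sum h1 i
      predictive_pos (hmem.1 l) (hmem.2 l) (h2 i l)
    have habs : ∀ i l, |Real.log (predictive L θ₀ (belief A L μ₀ ξ i ω) (ξ i ω) l)| ≤ U i ω :=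
      fun i l => Finset.single_le_sum
        (f := fun l => |Real.log (predictive L θ₀ (belief A L μ₀ ξ i ω) (ξ i ω) l)|)
        (fun _ _ => abs_nonneg _) (Finset.mem_univ l)
    constructor
    · refine le_belief_of_predictive_le hA.nonneg hμ₀ h1 hpos (U := fun i => U i ω)
        (fun i l => ?_) θ i k
      rw [← Real.log_le_iff_le_exp (hpos i l)]
      exact (le_abs_self _).trans (habs i l)
    · refine belief_le_of_le_predictive hA.nonneg hμ₀ h1 (U := fun i => U i ω)
        (fun i l => ?_) θ i k
      rw [← Real.le_log_iff_exp_le (hpos i l)]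
      exact neg_le_of_abs_le (habs i l)
  have hlinpos : ∀ n ω, (∀ l k, 0 < listProd (ratioMatrix A L θ₀ θ) (segment ξ 0 n ω).reverse l k) →
      ∀ k, 0 < linearBelief A L θ₀ θ μ₀ ξ n ω k := by
    intro n ω hn k
    obtain ⟨l₀, hl₀⟩ := hμ₀_pos
    exact Finset.sum_pos' (fun l _ => mul_nonneg (hn k l).le (hμ₀ l θ))
      ⟨l₀, Finset.mem_univ _, mul_pos (hn k l₀) hl₀⟩
  obtain ⟨N, hN⟩ := eventually_atTop.1 hγ.eventually_pos
  have hpos : ∀ᵐ ω ∂P, ∀ n, N ≤ n →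
      ∀ l k, 0 < listProd (ratioMatrix A L θ₀ θ) (segment ξ 0 n ω).reverse l k :=
    ae_all_iff.2 fun n => by
      by_cases hn : N ≤ n
      · filter_upwards [hN n hn] with ω hω _ using hω
      · exact ae_of_all _ fun ω hn' => absurd hn' hn
  refine ⟨?_, fun k => ?_⟩
  · filter_upwards [eventually_ge_atTop N] with n hn
    filter_upwards [hpos, hbounds] with ω h1 h2 k
    exact (mul_pos (Real.exp_pos _) (hlinpos n ω (h1 n hn) k)).trans_le (h2 n k).1
  · filter_upwards [hpos, hbounds, ae_all_iff.2 (hγ.tendsto_ae k),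
      h.ae_tendsto_log_predictive hA hA_stoch hμ₀ hμ₀_sum hμ₀_pos₀] with ω h1 h2 h3 h4
    have hU : Tendsto (fun i => U i ω) atTop (𝓝 0) := by
      have := tendsto_finsetSum Finset.univ fun l (_ : l ∈ Finset.univ) => (h4 l).abs
      simpa using this
    -- The accumulated normalization is a Cesàro mean of a null sequence, so it disappears after
    -- division by `n`.
    have hces : Tendsto (fun n : ℕ => (n : ℝ)⁻¹ * ∑ j ∈ Finset.range n, U j ω) atTop (𝓝 0) :=
      hU.cesaro
    have hlim : Tendsto (fun n : ℕ => (1 / (n : ℝ)) *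
        Real.log (linearBelief A L θ₀ θ μ₀ ξ n ω k)) atTop (𝓝 γ) :=
      tendsto_log_mulVec (Y := fun n =>
        listProd (ratioMatrix A L θ₀ θ) (segment ξ 0 n ω).reverse)
        (eventually_atTop.2 ⟨N, fun n hn l => h1 n hn k l⟩) h3 (fun l => hμ₀ l θ) hμ₀_pos
    have hlo := hlim.sub hces
    have hup := hlim.add hces
    rw [sub_zero] at hlo
    rw [add_zero] at hup
    refine (tendsto_of_tendsto_of_tendsto_of_le_of_le' hlo hup ?_ ?_).neg
    · filter_upwards [eventually_ge_atTop N] with n hn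
      have hlp := hlinpos n ω (h1 n hn) k
      have := Real.log_le_log (mul_pos (Real.exp_pos _) hlp) (h2 n k).1
      rw [Real.log_mul (Real.exp_pos _).ne' hlp.ne', Real.log_exp] at this
      rw [one_div, ← mul_sub]
      exact mul_le_mul_of_nonneg_left (by linarith) (by positivity)
    · filter_upwards [eventually_ge_atTop N] with n hn
      have hlp := hlinpos n ω (h1 n hn) k
      have := Real.log_le_log ((mul_pos (Real.exp_pos _) hlp).trans_le (h2 n k).1) (h2 n k).2
      rw [Real.log_mul (Real.exp_pos _).ne' hlp.ne', Real.log_exp] at this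
      rw [one_div, ← mul_add]
      exact mul_le_mul_of_nonneg_left (by linarith) (by positivity)

end DecayRate

end AADiffusion

/-! ### Assembly of the theorem -/

open AADiffusion

theorem lemma1
    -- finitely many agents and hypotheses
    {ι Θ : Type*} [Fintype ι] [DecidableEq ι] [Nonempty ι] [Fintype Θ]
    -- signal spaces with reference measures, and likelihood functions
    {X : ι → Type*} [∀ k, MeasurableSpace (X k)]
    (ν : ∀ k, Measure (X k)) [∀ k, SigmaFinite (ν k)]
    (L : ∀ k, Θ → X k → ℝ)
    (hL_meas : ∀ k θ, Measurable (L k θ))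
    (hL_nonneg : ∀ k θ x, 0 ≤ L k θ x)
    (hL_prob : ∀ k θ, IsProbabilityMeasure (lawOf (ν k) (L k θ)))
    -- the true hypothesis
    (θ₀ : Θ)
    -- signals: i.i.d. over time, with marginals given by the true hypothesis
    {Ω : Type*} [MeasurableSpace Ω] (P : Measure Ω) [IsProbabilityMeasure P]
    (ξ : ℕ → Ω → ∀ k, X k)
    (hξ_meas : ∀ i, Measurable (ξ i))
    (hξ_indep : iIndepFun ξ P)
    (hξ_ident : ∀ i, IdentDistrib (ξ i) (ξ 0) P P)
    (hξ_law : ∀ i k, P.map (fun ω => ξ i ω k) = lawOf (ν k) (L k θ₀))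
    -- finite KL divergences
    (hKL : ∀ k θ,
      InformationTheory.klDiv (lawOf (ν k) (L k θ₀)) (lawOf (ν k) (L k θ)) < ⊤)
    -- global identifiability
    (hIdent : ∀ θ, θ ≠ θ₀ → ∃ k,
      0 < InformationTheory.klDiv (lawOf (ν k) (L k θ₀)) (lawOf (ν k) (L k θ)))
    -- combination matrix: primitive and left-stochastic
    (A : Matrix ι ι ℝ) (hA_prim : A.IsPrimitive) (hA_stoch : ∀ k, ∑ l, A l k = 1)
    -- initial beliefs; no hypothesis is excluded by all agents
    (μ₀ : ι → Θ → ℝ) (hμ₀_nonneg : ∀ k θ, 0 ≤ μ₀ k θ) (hμ₀_sum : ∀ k, ∑ θ, μ₀ k θ = 1)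
    (hμ₀_pos : ∀ θ, ∃ k, 0 < μ₀ k θ)
    -- a false hypothesis
    (θ : Θ) (hθ : θ ≠ θ₀) :
    ∃ γ ρ : ℝ,
      IsGrowthRate P (prodY A L θ₀ θ ξ) γ ∧
      IsDecayRate P (belief A L μ₀ ξ) θ ρ ∧
      ρ = -γ ∧
      (∀ i : ℕ, 1 ≤ i →
        (∀ᵐ ω ∂P, 0 < colSumMin (prodY A L θ₀ θ ξ i ω)) ∧
        Integrable (fun ω => Real.log (colSumMin (prodY A L θ₀ θ ξ i ω))) P ∧
        (1 / (i : ℝ)) * ∫ ω, Real.log (colSumMin (prodY A L θ₀ θ ξ i ω)) ∂P ≤ γ) ∧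
      (∀ j : ℕ, 1 ≤ j →
        (∀ᵐ ω ∂P, 0 < colSumMax (prodY A L θ₀ θ ξ j ω)) ∧
        Integrable (fun ω => Real.log (colSumMax (prodY A L θ₀ θ ξ j ω))) P ∧
        γ ≤ (1 / (j : ℝ)) * ∫ ω, Real.log (colSumMax (prodY A L θ₀ θ ξ j ω)) ∂P) ∧
      (∀ k, 0 < A k k →
        ρ ≤ -Real.log (A k k) +
          (InformationTheory.klDiv (lawOf (ν k) (L k θ₀)) (lawOf (ν k) (L k θ))).toReal) := by
  have hiid : IsIID P ξ := ⟨hξ_meas, hξ_indep, hξ_ident⟩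
  have hsig := isSignal_of_klDiv_lt_top hL_meas hL_nonneg hL_prob hiid hξ_law hKL
  have hprod := hsig.isRandomProduct hA_prim θ
  obtain ⟨γ, hγ, hmin, hmax⟩ := hprod.exists_isGrowthRate
  have hY := hsig.ae_prodY_eq (A := A) θ
  -- Forward products give the statements about `Y`, reversed ones the decay of the beliefs; both
  -- have rate `γ`.
  refine ⟨γ, -γ, hγ.congr (hY.mono fun ω hω n => (hω n).symm),
    hsig.isDecayRate hA_prim hA_stoch hμ₀_nonneg hμ₀_sum (hμ₀_pos θ₀) (hμ₀_pos θ)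
      (hprod.isGrowthRate_reverse hγ), rfl, fun i hi => ?_, fun j hj => ?_, fun k hk => ?_⟩
  · have hi' : (0 : ℝ) < i := by exact_mod_cast hi
    have e : (fun ω => Real.log (colSumMin (listProd (ratioMatrix A L θ₀ θ) (segment ξ 0 i ω))))
        =ᵐ[P] fun ω => Real.log (colSumMin (prodY A L θ₀ θ ξ i ω)) := by
      filter_upwards [hY] with ω hω
      rw [hω]
    refine ⟨?_, (integrable_congr e).1 (hprod.integrable_logMin 0 i), ?_⟩
    · filter_upwards [hY] with ω hω
      rw [hω]
      exact hprod.comparable.colSumMin_listProd_pos _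
    · rw [← integral_congr_ae e, one_div_mul_eq_div, div_le_iff₀ hi']
      exact hmin i
  · have hj' : (0 : ℝ) < j := by exact_mod_cast hj
    have e : (fun ω => Real.log (colSumMax (listProd (ratioMatrix A L θ₀ θ) (segment ξ 0 j ω))))
        =ᵐ[P] fun ω => Real.log (colSumMax (prodY A L θ₀ θ ξ j ω)) := by
      filter_upwards [hY] with ω hω
      rw [hω]
    refine ⟨?_, (integrable_congr e).1 (hprod.integrable_logMax 0 j), ?_⟩
    · filter_upwards [hY] with ω hω
      rw [hω]
      exact hprod.comparable.colSumMax_listProd_pos _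
    · rw [← integral_congr_ae e, one_div_mul_eq_div, le_div_iff₀ hj']
      exact hmax j
  · have := hsig.log_diag_sub_le hA_prim.nonneg hk hγ
    linarith
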